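/- Let $n\ge 1$. For a finite alphabet $\Sigma$ with a distinguished empty state $0$, let $\mathcal C_\Sigma$ be the set of maps $c:\mathbb Z^n\to\Sigma$ with $c_i\neq 0$ for only finitely many $i$, and let $\mathcal H_\Sigma^{\mathbb Z^n}$ be the Hilbert space with orthonormal basis $\{|c\rangle\}_{c\in\mathcal C_\Sigma}$; write $|\mathbf 0\rangle$ for the basis vector of the all-empty configuration. A *QCA* over $\Sigma$ is a unitary operator $G$ on $\mathcal H_\Sigma^{\mathbb Z^n}$ that commutes with the unit translations along the $n$ axes and is causal: there is a finite $\mathcal N\subset\mathbb Z^n$ such that for every cell $x$ there is a function $f$ with $(G\rho G^\dagger)_x=f(\rho_{x+\mathcal N})$ for every density matrix $\rho$, where $\rho_S$ denotes the partial trace of $\rho$ over all cells outside $S$. A *PQCA* over a finite alphabet $\Lambda\ni 0$ is induced by a scattering unitary $U$ on $(\mathbb C^{\Lambda})^{\otimes 2^n}$ with $U|0\ldots0\rangle=|0\ldots0\rangle$. Let $J=\bigotimes_{2\mathbb Z^n}U$, acting on each hypercube $2x+\{0,1\}^n$, and let $\tau$ be the translation along $(1,\ldots,1)$. The PQCA evolves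 by $J$ at even steps $t=0,2,\ldots$ and by $\tau^\dagger J\tau$ at odd steps; $H_U^{(k)}$ denotes its evolution over its first $k$ steps. For an operator $T$ and $s\ge1$, let $T_{[s]}$ be $T$ viewed as acting on configurations of supercells, each hypercube $sx+\{0,\ldots,s-1\}^n$ being one supercell (whose empty state is the word $0\ldots0$). The PQCA *intrinsically simulates* an operator $G$ if there are integers $s\ge 1$, even $s'\ge 2$, even $k\ge 2$ and an isometry $E_0:\mathbb C^{\Sigma^{s^n}}\to\mathbb C^{\Lambda^{s'^n}}$ with $E_0|0\ldots0\rangle=|0\ldots0\rangle$ such that $E=\bigotimes_{\mathbb Z^n}E_0$ satisfies $$\bigl(H_U^{(k)}\bigr)_{[s']}\,E=E\,G_{[s]} .$$ **Theorem (PQCA are intrinsically universal).** For every $n$-dimensional QCA $G$ there are a complex number $z$ with $|z|=1$ and $zG|\mathbf 0\rangle=|\mathbf 0\rangle$ (so $z=1$ if $G|\mathbf 0\rangle=|\mathbf 0\rangle$) and an $n$-dimensional PQCA that intrinsically simulates $zG$. -/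

import Mathlib

universe u v

noncomputable section

namespace QCA

open scoped Matrix

/-! ### Configurations and state space -/

/-- The grid of cells. -/
abbrev Grid (n : ℕ) : Type := Fin n → ℤ

/-- Configurations: maps from the grid to the alphabet `A` that take the empty state `0` on all but
finitely many cells. -/
abbrev Config (n : ℕ) (A : Type u) [Zero A] : Type u := Grid n →₀ A

/-- The Hilbert space `ℓ²` having the set `X` as an orthonormal basis. -/
abbrev L2 (X : Type u) : Type u := lp (fun _ : X => ℂ) 2

/-- The Hilbert space of configurations. -/
abbrev StateSpace (n : ℕ) (A : Type u) [Zero A] : Type u := L2 (Config n A)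

/-- Bounded operators over the Hilbert space of configurations. -/
abbrev Op (n : ℕ) (A : Type u) [Zero A] : Type u := StateSpace n A →L[ℂ] StateSpace n A

open Classical in
/-- The basis vector `|x⟩`. -/
def ket {X : Type u} (x : X) : L2 X := lp.single 2 x 1

theorem memℓp_comp {X : Type u} {Y : Type v} (e : Y ≃ X) {f : X → ℂ} (h : Memℓp f 2) :
    Memℓp (fun y => f (e y)) 2 := by
  rw [memℓp_gen_iff (by norm_num)] at h ⊢
  exact h.comp_injective e.injective

/-- The unitary `|x⟩ ↦ |e x⟩` induced by a bijection `e` of the basis labels. -/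
def relabel {X : Type u} {Y : Type v} (e : X ≃ Y) : L2 X ≃ₗᵢ[ℂ] L2 Y where
  toFun f := ⟨fun y => f (e.symm y), memℓp_comp e.symm (lp.memℓp f)⟩
  invFun g := ⟨fun x => g (e x), memℓp_comp e (lp.memℓp g)⟩
  left_inv f := by ext x; simp
  right_inv g := by ext y; simp
  map_add' f g := rfl
  map_smul' a f := rfl
  norm_map' f := by
    rw [lp.norm_eq_tsum_rpow (by norm_num), lp.norm_eq_tsum_rpow (by norm_num)]
    congr 1
    exact e.symm.tsum_eq (fun x => ‖f x‖ ^ (2 : ENNReal).toReal)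

theorem relabel_ket {X : Type u} {Y : Type v} (e : X ≃ Y) (x : X) :
    relabel e (ket x) = ket (e x) := by
  classical
  ext y
  change (ket x : L2 X) (e.symm y) = (ket (e x) : L2 Y) y
  simp only [ket, lp.single_apply, Pi.single_apply, Equiv.symm_apply_eq]

/-- Conjugation of an operator by `relabel e`. -/
def conjRelabel {X : Type u} {Y : Type v} (e : X ≃ Y) (T : L2 X →L[ℂ] L2 X) :
    L2 Y →L[ℂ] L2 Y :=
  (relabel e : L2 X →L[ℂ] L2 Y) ∘L T ∘L ((relabel e).symm : L2 Y →L[ℂ] L2 X)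

/-! ### Quantum cellular automata -/

section Basic

variable {n : ℕ} {A : Type u} [Zero A]

/-- The translation of configurations along `v`: `c'_i = c_{i + v}`. -/
def shift (v : Grid n) : Config n A ≃ Config n A where
  toFun c := Finsupp.equivMapDomain (Equiv.subRight v) c
  invFun c := Finsupp.equivMapDomain (Equiv.addRight v) c
  left_inv c := by ext i; simp
  right_inv c := by ext i; simp

theorem shift_apply (v : Grid n) (c : Config n A) (i : Grid n) : shift v c i = c (i + v) := rfl

/-- The translation operator along `v`. -/
def translation (v : Grid n) : StateSpace n A ≃ₗᵢ[ℂ] StateSpace n A := relabel (shift v)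

variable (n A) in
/-- The diagonal translation `τ = τ₁ ⋯ τₙ`. -/
def diag : StateSpace n A ≃ₗᵢ[ℂ] StateSpace n A := translation (fun _ => 1)

/-- Translation-invariance: commutation with the unit translation along each dimension. -/
def TranslationInvariant (G : Op n A) : Prop :=
  ∀ (k : Fin n) (ψ : StateSpace n A),
    G (translation (Pi.single k 1) ψ) = translation (Pi.single k 1) (G ψ)

/-- Density matrices: positive operators of trace one. -/
def IsDensity (ρ : Op n A) : Prop :=
  ρ.IsPositive ∧ HasSum (fun c : Config n A => inner ℂ (ket c) (ρ (ket c))) 1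

open Classical in
/-- The configuration that coincides with `a` on `S` and with `e` outside of `S`. -/
def glue (S : Finset (Grid n)) (a : S → A) (e : Config n A) : Config n A :=
  Finsupp.onFinset (S ∪ e.support) (fun x => if h : x ∈ S then a ⟨x, h⟩ else e x) (by
    intro x hx
    by_cases h : x ∈ S
    · simp [h]
    · simpa [h] using hx)

theorem glue_injective (T : Finset (Grid n)) :
    Function.Injective fun a : T → A => glue T a 0 := by
  intro a b h
  ext x
  have := DFunLike.congr_fun h x.1
  simpa [glue] using this

theorem mem_range_glue (T : Finset (Grid n)) (d : Config n A) (h : d.support ⊆ T) :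
    d ∈ Set.range fun a : T → A => glue T a 0 := by
  refine ⟨fun x => d x, ?_⟩
  ext x
  by_cases hx : x ∈ T
  · simp [glue, hx]
  · have : d x = 0 := Finsupp.notMem_support_iff.1 fun h' => hx (h h')
    simp [glue, hx, this]

theorem support_glue (T : Finset (Grid n)) (a : T → A) : (glue T a 0).support ⊆ T := by
  intro x hx
  by_contra h
  simp [glue, h] at hx

/-- The reduced density matrix of `ρ` on the finite set of cells `S`, i.e. the partial trace over all
cells outside of `S`: its `(a, b)` entry is `∑ₑ ⟨a e| ρ |b e⟩`, where `e` ranges over the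
configurations of the complement of `S` (those which are empty on `S`). -/
def reduced (S : Finset (Grid n)) (ρ : Op n A) : Matrix (S → A) (S → A) ℂ :=
  fun a b => ∑' e : {e : Config n A // ∀ x ∈ S, e x = 0},
    inner ℂ (ket (glue S a e.1)) (ρ (ket (glue S b e.1)))

/-- Causality with neighbourhood `N`: the reduced density matrix of each cell `x` after the evolution
is a function of the reduced density matrix of the cells `x + N` before. -/
def CausalWith (N : Finset (Grid n)) (G : Op n A) : Prop :=
  ∀ x : Grid n, ∃ f : Matrix (N.map (addLeftEmbedding x) → A) (N.map (addLeftEmbedding x) → A) ℂ →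
      Matrix (({x} : Finset (Grid n)) → A) (({x} : Finset (Grid n)) → A) ℂ,
    ∀ ρ : Op n A, IsDensity ρ →
      reduced {x} (G ∘L ρ ∘L G.adjoint) = f (reduced (N.map (addLeftEmbedding x)) ρ)

/-- A quantum cellular automaton: a unitary, translation-invariant operator that is causal with some
finite neighbourhood. -/
structure IsQCA (G : Op n A) : Prop where
  unitary : G ∈ unitary (Op n A)
  translationInvariant : TranslationInvariant G
  causal : ∃ N : Finset (Grid n), CausalWith N G

end Basic

/-! ### Homogeneous tensor products of quiescence-preserving local isometries -/

/-- An isometry from `ℂ^A` to `ℂ^B` that preserves quiescence, i.e. maps `|0⟩` to `|0⟩`; it is given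
by its matrix. -/
structure LocalIsometry (A : Type u) (B : Type v) [Fintype A] [Zero A] [DecidableEq A]
    [Fintype B] [Zero B] [DecidableEq B] where
  mat : Matrix B A ℂ
  isometry : matᴴ * mat = 1
  quiescent : mat *ᵥ Pi.single 0 1 = Pi.single 0 1

namespace LocalIsometry

variable {A : Type u} {B : Type v} [Fintype A] [Zero A] [DecidableEq A]
  [Fintype B] [Zero B] [DecidableEq B] {n : ℕ}

theorem mat_zero (V : LocalIsometry A B) (b : B) : V.mat b 0 = if b = 0 then 1 else 0 := by
  have h := congrFun V.quiescent b
  simpa [Pi.single_apply] using h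

/-- The amplitude `⟨d| ⨂ V |c⟩`; all but finitely many factors are `⟨0|V|0⟩ = 1`. -/
def amplitude (V : LocalIsometry A B) (c : Config n A) (d : Config n B) : ℂ :=
  ∏ᶠ x, V.mat (d x) (c x)

theorem amplitude_eq_zero (V : LocalIsometry A B) (c : Config n A) (d : Config n B)
    (h : ¬ d.support ⊆ c.support) : V.amplitude c d = 0 := by
  obtain ⟨x, hxd, hxc⟩ := Finset.not_subset.1 h
  refine finprod_eq_zero _ x ?_ ?_
  · rw [Finsupp.notMem_support_iff.1 hxc, V.mat_zero, if_neg (Finsupp.mem_support_iff.1 hxd)]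
  · refine (c.support ∪ d.support).finite_toSet.subset fun y hy => ?_
    by_contra hy'
    simp only [Finset.coe_union, Set.mem_union, Finset.mem_coe, Finsupp.mem_support_iff,
      not_or, not_not] at hy'
    exact hy (by simp [hy'.1, hy'.2, V.mat_zero])

theorem amplitude_eq_prod (V : LocalIsometry A B) (T : Finset (Grid n)) (c : Config n A)
    (d : Config n B) (hc : c.support ⊆ T) (hd : d.support ⊆ T) :
    V.amplitude c d = ∏ x : T, V.mat (d x) (c x) := by
  rw [Finset.prod_coe_sort T (fun x => V.mat (d x) (c x))]
  refine finprod_eq_prod_of_mulSupport_subset _ fun y hy => ?_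
  by_contra hy'
  have h1 : c y = 0 := Finsupp.notMem_support_iff.1 fun h => hy' (hc h)
  have h2 : d y = 0 := Finsupp.notMem_support_iff.1 fun h => hy' (hd h)
  exact hy (by simp [h1, h2, V.mat_zero])

/-- The vector `⨂ V |c⟩`. -/
def column (V : LocalIsometry A B) (c : Config n A) : StateSpace n B :=
  ⟨fun d => V.amplitude c d, by
    refine (memℓp_zero ?_).of_exponent_ge zero_le
    refine (Set.finite_range fun a : c.support → B => glue c.support a 0).subset fun d hd => ?_
    refine mem_range_glue _ _ ?_
    by_contra h
    exact hd (V.amplitude_eq_zero c d h)⟩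

theorem orthonormal_column (V : LocalIsometry A B) :
    Orthonormal ℂ (V.column : Config n A → StateSpace n B) := by
  classical
  rw [orthonormal_iff_ite]
  intro c c'
  set T := c.support ∪ c'.support with hT
  have hc : c.support ⊆ T := Finset.subset_union_left
  have hc' : c'.support ⊆ T := Finset.subset_union_right
  rw [lp.inner_eq_tsum]
  rw [← (glue_injective (A := B) T).tsum_eq]
  · rw [tsum_fintype]
    have key : ∀ a : T → B, inner ℂ (V.column c (glue T a 0)) (V.column c' (glue T a 0)) =
        ∏ x : T, star (V.mat (a x) (c x)) * V.mat (a x) (c' x) := by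
      intro a
      change inner ℂ (V.amplitude c (glue T a 0)) (V.amplitude c' (glue T a 0)) = _
      rw [V.amplitude_eq_prod T c _ hc (support_glue T a),
        V.amplitude_eq_prod T c' _ hc' (support_glue T a), Finset.prod_mul_distrib]
      simp [glue, mul_comm]
    rw [Finset.sum_congr rfl fun a _ => key a,
      ← Fintype.prod_sum fun (x : T) (b : B) => star (V.mat b (c x)) * V.mat b (c' x)]
    have h2 : ∀ x : T, ∑ b, star (V.mat b (c x)) * V.mat b (c' x) =
        if c x = c' x then 1 else 0 := by
      intro x
      have := congrFun (congrFun V.isometry (c x)) (c' x)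
      simpa [Matrix.mul_apply, Matrix.one_apply] using this
    rw [Finset.prod_congr rfl fun x _ => h2 x]
    split_ifs with h
    · simp [h]
    · obtain ⟨x, hx⟩ : ∃ x, c x ≠ c' x := by
        by_contra! h'
        exact h (Finsupp.ext h')
      have hxT : x ∈ T := by
        by_contra h'
        exact hx ((Finsupp.notMem_support_iff.1 fun h1 => h' (hc h1)).trans
          (Finsupp.notMem_support_iff.1 fun h1 => h' (hc' h1)).symm)
      exact Finset.prod_eq_zero (Finset.mem_univ (⟨x, hxT⟩ : T)) (if_neg hx)
  · intro d hd
    refine mem_range_glue T d ?_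
    by_contra h
    refine hd ?_
    have : V.column c d = 0 := V.amplitude_eq_zero c d fun h' => h (h'.trans hc)
    simp [this]

/-- The isometry `⨂_{ℤⁿ} V` between Hilbert spaces of configurations. -/
def tensor (n : ℕ) (V : LocalIsometry A B) : StateSpace n A →L[ℂ] StateSpace n B :=
  (V.orthonormal_column (n := n)).orthogonalFamily.linearIsometry.toContinuousLinearMap

theorem tensor_ket (V : LocalIsometry A B) (c : Config n A) (d : Config n B) :
    V.tensor n (ket c) d = ∏ᶠ x, V.mat (d x) (c x) := by
  classical
  have h : V.tensor n (ket c) = V.column c := by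
    have := (V.orthonormal_column (n := n)).orthogonalFamily.linearIsometry_apply_single
      (i := c) (1 : ℂ)
    simp only [LinearIsometry.toSpanSingleton_apply, one_smul] at this
    rw [← this]
    simp only [tensor, ket, LinearIsometry.coe_toContinuousLinearMap]
    congr!
  rw [h]
  rfl

end LocalIsometry

/-! ### Grouping cells into supercells -/

/-- The alphabet of hypercubic supercells of side `s`: words over `A` indexed by `{0, …, s-1}ⁿ`. Its
empty state is the word `0…0`. -/
abbrev Block (n s : ℕ) (A : Type u) : Type u := (Fin n → Fin s) → A

section Grouping

variable {n : ℕ} {A : Type u} [Zero A]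

/-- Position `s x + p` of the `p`-th cell of the supercell `x`. -/
def cellAt (s : ℕ) (x : Grid n) (p : Fin n → Fin s) : Grid n := fun i => s * x i + (p i : ℕ)

/-- The supercell of the cell `y`. -/
def supercellOf (s : ℕ) (y : Grid n) : Grid n := fun i => y i / s

/-- The position of the cell `y` within its supercell. -/
def offsetOf (s : ℕ) [NeZero s] (y : Grid n) : Fin n → Fin s := fun i =>
  ⟨(y i % s).toNat, by
    have hs : (0 : ℤ) < s := by exact_mod_cast Nat.pos_of_ne_zero (NeZero.ne s)
    have h1 := Int.emod_lt_of_pos (y i) hs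
    have h2 := Int.emod_nonneg (y i) hs.ne'
    omega⟩

theorem cellAt_of (s : ℕ) [NeZero s] (y : Grid n) :
    cellAt s (supercellOf s y) (offsetOf s y) = y := by
  funext i
  have hs : (s : ℤ) ≠ 0 := by exact_mod_cast NeZero.ne s
  have h2 := Int.emod_nonneg (y i) hs
  simp only [cellAt, supercellOf, offsetOf, Int.toNat_of_nonneg h2]
  exact Int.mul_ediv_add_emod (y i) s

theorem supercellOf_cellAt (s : ℕ) [NeZero s] (x : Grid n) (p : Fin n → Fin s) :
    supercellOf s (cellAt s x p) = x := by
  funext i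
  have hs : (s : ℤ) ≠ 0 := by exact_mod_cast NeZero.ne s
  have h : ((p i : ℕ) : ℤ) / s = 0 :=
    Int.ediv_eq_zero_of_lt (by positivity) (by exact_mod_cast (p i).2)
  simp only [cellAt, supercellOf]
  rw [Int.mul_add_ediv_left _ _ hs, h, add_zero]

theorem offsetOf_cellAt (s : ℕ) [NeZero s] (x : Grid n) (p : Fin n → Fin s) :
    offsetOf s (cellAt s x p) = p := by
  funext i
  have h : ((p i : ℕ) : ℤ) % s = (p i : ℕ) :=
    Int.emod_eq_of_lt (by positivity) (by exact_mod_cast (p i).2)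
  apply Fin.ext
  simp only [cellAt, offsetOf, Int.mul_add_emod_self_left, h, Int.toNat_natCast]

/-- Grouping each hypercube of `sⁿ` adjacent cells of a configuration into one supercell. -/
def group (s : ℕ) [NeZero s] : Config n A ≃ Config n (Block n s A) where
  toFun c := Finsupp.ofSupportFinite (fun x p => c (cellAt s x p)) (by
    refine (c.support.finite_toSet.image (supercellOf s)).subset fun x hx => ?_
    obtain ⟨p, hp⟩ := Function.ne_iff.1 hx
    exact ⟨cellAt s x p, Finsupp.mem_support_iff.2 hp, supercellOf_cellAt s x p⟩)
  invFun d := Finsupp.ofSupportFinite (fun y => d (supercellOf s y) (offsetOf s y)) (by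
    refine ((d.support.finite_toSet.prod Set.finite_univ).image
      (fun q : Grid n × (Fin n → Fin s) => cellAt s q.1 q.2)).subset fun y hy => ?_
    refine ⟨(supercellOf s y, offsetOf s y), ⟨?_, Set.mem_univ _⟩, cellAt_of s y⟩
    refine Finsupp.mem_support_iff.2 fun h => hy ?_
    simp [h])
  left_inv c := by
    ext y
    simp [Finsupp.ofSupportFinite_coe, cellAt_of]
  right_inv d := by
    ext x p
    simp [Finsupp.ofSupportFinite_coe, supercellOf_cellAt, offsetOf_cellAt]

/-- The operator `T` seen as an operator over configurations of supercells of side `s`. -/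
def grouped (s : ℕ) [NeZero s] (T : Op n A) : Op n (Block n s A) := conjRelabel (group s) T

end Grouping

/-! ### Partitioned quantum cellular automata -/

/-- Scattering unitaries: unitary operators on the hypercubes of `2ⁿ` cells that preserve
quiescence. -/
structure ScatteringUnitary (n : ℕ) (A : Type u) [Fintype A] [Zero A] [DecidableEq A] where
  mat : Matrix (Block n 2 A) (Block n 2 A) ℂ
  unitary : mat ∈ Matrix.unitaryGroup (Block n 2 A) ℂ
  quiescent : mat *ᵥ Pi.single 0 1 = Pi.single 0 1

namespace ScatteringUnitary

variable {n : ℕ} {A : Type u} [Fintype A] [Zero A] [DecidableEq A]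

/-- A scattering unitary as an isometry of the space of one hypercube. -/
def toLocalIsometry (U : ScatteringUnitary n A) : LocalIsometry (Block n 2 A) (Block n 2 A) where
  mat := U.mat
  isometry := Matrix.mem_unitaryGroup_iff'.1 U.unitary
  quiescent := U.quiescent

/-- `J = ⨂_{2ℤⁿ} U`, applying `U` to each of the hypercubes `2x + {0,1}ⁿ`. -/
def J (U : ScatteringUnitary n A) : Op n A :=
  conjRelabel (group 2).symm (U.toLocalIsometry.tensor n)

/-- The evolution of the PQCA at time step `t`: `J` at even steps and `τ† J τ` at odd steps. -/
def step (U : ScatteringUnitary n A) (t : ℕ) : Op n A :=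
  if Even t then U.J
  else ((diag n A).symm : StateSpace n A →L[ℂ] StateSpace n A) ∘L U.J ∘L
    (diag n A : StateSpace n A →L[ℂ] StateSpace n A)

/-- The global evolution of the PQCA over its first `t` steps. -/
def evolution (U : ScatteringUnitary n A) : ℕ → Op n A
  | 0 => ContinuousLinearMap.id ℂ _
  | t + 1 => U.step t ∘L U.evolution t

end ScatteringUnitary

/-! ### Simulation -/

section Simulation

variable {n : ℕ} {A : Type u} [Fintype A] [Zero A] [DecidableEq A]
  {B : Type v} [Fintype B] [Zero B] [DecidableEq B]

/-- `H` directly simulates `G`: there is a cellwise, quiescence-preserving isometric encoding `E` with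
`H E = E G`. -/
def DirectlySimulates (H : Op n B) (G : Op n A) : Prop :=
  ∃ E : LocalIsometry A B, H ∘L E.tensor n = E.tensor n ∘L G

/-- The PQCA of scattering unitary `U` intrinsically simulates `G`: once cells have been grouped into
supercells (of side `s` for `G` and `s'` for the PQCA), `k` steps of the PQCA directly simulate one
step of `G`. As a PQCA is homogeneous over two time steps and two cells, `k` and `s'` are required to
be even, so that the evolution over any `k i` steps is the `i`-th power of the one over `k` steps, and
that it is invariant under translations of the supercells. -/
def IntrinsicallySimulates (U : ScatteringUnitary n B) (G : Op n A) : Prop :=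
  ∃ (s s' k : ℕ) (_ : NeZero s) (_ : NeZero s'), Even s' ∧ Even k ∧ 0 < k ∧
    DirectlySimulates (grouped s' (U.evolution k)) (grouped s G)

end Simulation

end QCA

end

/-!
The construction follows Arrighi, Nesme and Werner. Give every cell a second, initially empty layer
and let `G` act on the first layer. By causality, the Heisenberg picture `T ↦ (G ⊗ 1)† T (G ⊗ 1)`
turns the exchange of the two layers at a single cell into a gate that only touches the
neighbourhood of that cell. The exchanges commute, hence so do these gates, and as `G |0⟩ = |0⟩`
their product over all cells, followed by the exchange of the layers everywhere, maps `ψ ⊗ 0` to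
`G ψ ⊗ 0`. When `G` has radius `r`, the gates whose centres agree modulo `2r + 1` act on disjoint
supercells, so `G` becomes a finite circuit of gates applied to translates of the partition into
supercells.

A partitioned automaton applies the same unitary at each step; it runs such a circuit on cells with
one track per time step, the unitary moving the data on each track to the next one, so that the gate
depends on the step. Even steps distribute a supercell over the cells of a hypercube in such a way
that the shifted hypercubes of the odd steps contain a translated window of cells.

As for the phase, `G |0⟩` is translation-invariant and square-summable, hence a multiple of `|0⟩`.
-/

universe w

noncomputable section

namespace QCA

open scoped Matrix

/-! ### Operators on `ℓ²` -/

section Ket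

variable {X : Type u} {Y : Type v} {Z : Type w}

theorem ket_apply [DecidableEq X] (x y : X) : (ket x : L2 X) y = if y = x then 1 else 0 := by
  simp only [ket, lp.single_apply, Pi.single_apply]
  congr

theorem inner_ket_left (x : X) (φ : L2 X) : inner ℂ (ket x) φ = φ x := by
  simp [ket, lp.inner_single_left]

theorem norm_ket (x : X) : ‖(ket x : L2 X)‖ = 1 := by
  simp [ket, lp.norm_single]

/-- The Hilbert basis `x ↦ |x⟩` of `ℓ²(X)`. -/
def ketBasis (X : Type u) : HilbertBasis X ℂ (L2 X) := ⟨LinearIsometryEquiv.refl ℂ (L2 X)⟩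

theorem coe_ketBasis : ⇑(ketBasis X) = ket := by
  classical
  funext x
  rw [← HilbertBasis.repr_symm_single]
  change lp.single 2 x 1 = ket x
  rw [ket]

theorem orthonormal_ket : Orthonormal ℂ (ket : X → L2 X) :=
  coe_ketBasis (X := X) ▸ (ketBasis X).orthonormal

theorem clm_ext_ket {F : Type*} [NormedAddCommGroup F] [NormedSpace ℂ F] {S T : L2 X →L[ℂ] F}
    (h : ∀ x, S (ket x) = T (ket x)) : S = T := by
  refine ContinuousLinearMap.ext_on
    (Submodule.dense_iff_topologicalClosure_eq_top.2 (ketBasis X).dense_span) ?_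
  rintro _ ⟨x, rfl⟩
  simpa only [coe_ketBasis] using h x

/-- The isometry `|x⟩ ↦ v x` onto the closed span of an orthonormal family `v`. -/
def ofOrthonormal {H : Type*} [NormedAddCommGroup H] [InnerProductSpace ℂ H] [CompleteSpace H]
    {v : X → H} (hv : Orthonormal ℂ v) : L2 X →ₗᵢ[ℂ] H :=
  hv.orthogonalFamily.linearIsometry

theorem ofOrthonormal_ket {H : Type*} [NormedAddCommGroup H] [InnerProductSpace ℂ H]
    [CompleteSpace H] {v : X → H} (hv : Orthonormal ℂ v) (x : X) :
    ofOrthonormal hv (ket x) = v x := by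
  classical
  have := hv.orthogonalFamily.linearIsometry_apply_single (i := x) (1 : ℂ)
  simpa only [LinearIsometry.toSpanSingleton_apply, one_smul, ofOrthonormal, ket] using this

/-- The isometry `|x⟩ ↦ |f x⟩` induced by an injection of the basis labels. -/
def embed (f : X ↪ Y) : L2 X →L[ℂ] L2 Y :=
  (ofOrthonormal (orthonormal_ket.comp f f.injective)).toContinuousLinearMap

@[simp]
theorem embed_ket (f : X ↪ Y) (x : X) : embed f (ket x) = ket (f x) :=
  ofOrthonormal_ket (orthonormal_ket.comp f f.injective) x

/-- The restriction `φ ↦ φ ∘ f` along an injection of the basis labels. -/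
def restrict (f : X ↪ Y) : L2 Y →L[ℂ] L2 X := (embed f).adjoint

@[simp]
theorem restrict_apply (f : X ↪ Y) (φ : L2 Y) (x : X) : restrict f φ x = φ (f x) := by
  rw [← inner_ket_left, restrict, ContinuousLinearMap.adjoint_inner_right, embed_ket,
    inner_ket_left]

theorem restrict_ket (f : X ↪ Y) (x : X) : restrict f (ket (f x)) = ket x := by
  classical
  ext y
  simp [ket_apply]

theorem restrict_ket_of_notMem (f : X ↪ Y) {y : Y} (h : y ∉ Set.range f) :
    restrict f (ket y) = 0 := by
  classical
  ext x
  simp only [restrict_apply, ket_apply, lp.coeFn_zero, Pi.zero_apply, ite_eq_right_iff,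
    one_ne_zero]
  exact fun h' => h ⟨x, h'⟩

theorem embed_apply_eq_inner (f : X ↪ Y) (φ : L2 X) (y : Y) :
    embed f φ y = inner ℂ (restrict f (ket y)) φ := by
  rw [← inner_ket_left, restrict, ContinuousLinearMap.adjoint_inner_left]

theorem embed_apply_of_notMem (f : X ↪ Y) (φ : L2 X) {y : Y} (h : y ∉ Set.range f) :
    embed f φ y = 0 := by
  rw [embed_apply_eq_inner, restrict_ket_of_notMem f h, inner_zero_left]

theorem relabel_apply (e : X ≃ Y) (φ : L2 X) (y : Y) : relabel e φ y = φ (e.symm y) := rfl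

theorem conjRelabel_ket (e : X ≃ Y) (T : L2 X →L[ℂ] L2 X) (y : Y) :
    conjRelabel e T (ket y) = relabel e (T (ket (e.symm y))) := by
  change relabel e (T (relabel e.symm (ket y))) = _
  rw [relabel_ket]

end Ket

/-! ### Composition of local isometries -/

theorem ite_prod_eq {ι R : Type*} [Fintype ι] [CommSemiring R] {C : Type*} [DecidableEq C]
    (f g : ι → C) : (∏ i, if f i = g i then (1 : R) else 0) = if f = g then 1 else 0 := by
  simp [Finset.prod_ite_zero, funext_iff]

namespace LocalIsometry

variable {A : Type u} {B : Type v} {C : Type w} [Fintype A] [Zero A] [DecidableEq A]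
  [Fintype B] [Zero B] [DecidableEq B] [Fintype C] [Zero C] [DecidableEq C] {n : ℕ}

attribute [ext] LocalIsometry

theorem sum_conj_mat_mul_mat (V : LocalIsometry A B) (a a' : A) :
    ∑ b, star (V.mat b a) * V.mat b a' = if a = a' then 1 else 0 := by
  simpa only [Matrix.mul_apply, Matrix.conjTranspose_apply, Matrix.one_apply] using
    congrFun₂ V.isometry a a'

theorem finite_mulSupport (V : LocalIsometry A B) (c : Config n A) (d : Config n B) :
    (Function.mulSupport fun x => V.mat (d x) (c x)).Finite := by
  refine (c.support ∪ d.support).finite_toSet.subset fun y hy => ?_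
  by_contra hy'
  simp only [Finset.coe_union, Set.mem_union, Finset.mem_coe, Finsupp.mem_support_iff,
    not_or, not_not] at hy'
  exact hy (by simp [hy'.1, hy'.2, V.mat_zero])

theorem tensor_ket_eq_sum (V : LocalIsometry A B) (T : Finset (Grid n)) (c : Config n A)
    (hc : c.support ⊆ T) :
    V.tensor n (ket c) = ∑ a : T → B, (∏ x, V.mat (a x) (c x)) • ket (glue T a 0) := by
  classical
  ext d
  rw [tensor_ket, lp.coeFn_sum, Finset.sum_apply]
  simp only [lp.coeFn_smul, Pi.smul_apply, ket_apply, smul_eq_mul, mul_ite, mul_one, mul_zero]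
  by_cases hd : d.support ⊆ T
  · obtain ⟨a, rfl⟩ := mem_range_glue T d hd
    simp only [(glue_injective T).eq_iff, Finset.sum_ite_eq, Finset.mem_univ, if_true]
    refine (V.amplitude_eq_prod T c _ hc hd).trans (Finset.prod_congr rfl fun x _ => ?_)
    simp [glue]
  · rw [Finset.sum_eq_zero fun a _ => if_neg ?_]
    · exact V.amplitude_eq_zero c d fun h => hd (h.trans hc)
    · rintro rfl
      exact hd (support_glue T a)

/-- The composition of local isometries. -/
def comp (V : LocalIsometry B C) (W : LocalIsometry A B) : LocalIsometry A C where
  mat := V.mat * W.mat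
  isometry := by
    rw [Matrix.conjTranspose_mul, Matrix.mul_assoc, ← Matrix.mul_assoc V.matᴴ, V.isometry,
      Matrix.one_mul, W.isometry]
  quiescent := by rw [← Matrix.mulVec_mulVec, W.quiescent, V.quiescent]

theorem comp_assoc {D : Type*} [Fintype D] [Zero D] [DecidableEq D] (U : LocalIsometry C D)
    (V : LocalIsometry B C) (W : LocalIsometry A B) : (U.comp V).comp W = U.comp (V.comp W) :=
  LocalIsometry.ext (Matrix.mul_assoc _ _ _)

theorem tensor_comp (V : LocalIsometry B C) (W : LocalIsometry A B) :
    (V.comp W).tensor n = V.tensor n ∘L W.tensor n := by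
  classical
  refine clm_ext_ket fun c => ?_
  ext d
  set T := c.support ∪ d.support
  have hc : c.support ⊆ T := Finset.subset_union_left
  have hd : d.support ⊆ T := Finset.subset_union_right
  have hV : ∀ a : T → B, V.tensor n (ket (glue T a 0)) d = ∏ x : T, V.mat (d x) (a x) :=
    fun a => by
      rw [tensor_ket]
      refine (V.amplitude_eq_prod T _ d (support_glue T a) hd).trans
        (Finset.prod_congr rfl fun x _ => ?_)
      simp [glue]
  calc (V.comp W).tensor n (ket c) d = ∏ x : T, ∑ b, V.mat (d x) b * W.mat b (c x) := by
        rw [tensor_ket]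
        exact (V.comp W).amplitude_eq_prod T c d hc hd
    _ = ∑ a : T → B, ∏ x : T, V.mat (d x) (a x) * W.mat (a x) (c x) :=
        Fintype.prod_sum fun (x : T) b => V.mat (d x) b * W.mat b (c x)
    _ = V.tensor n (W.tensor n (ket c)) d := by
        rw [W.tensor_ket_eq_sum T c hc, map_sum, lp.coeFn_sum, Finset.sum_apply]
        refine Finset.sum_congr rfl fun a _ => ?_
        rw [map_smul, lp.coeFn_smul, Pi.smul_apply, hV, smul_eq_mul, Finset.prod_mul_distrib,
          mul_comm]

/-- The quiescent isometry `|a⟩ ↦ |f a⟩` induced by an injection `f` with `f 0 = 0`. -/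
def ofInjective (f : A → B) (hf : Function.Injective f) (h0 : f 0 = 0) : LocalIsometry A B where
  mat := Matrix.of fun b a => if b = f a then 1 else 0
  isometry := by
    ext a a'
    simp [Matrix.mul_apply, Matrix.one_apply, hf.eq_iff, eq_comm]
  quiescent := by
    ext b
    simp [h0, Pi.single_apply]

theorem comp_ofInjective_mat (V : LocalIsometry B C) (f : A → B) (hf : Function.Injective f)
    (h0 : f 0 = 0) (c : C) (a : A) : (V.comp (ofInjective f hf h0)).mat c a = V.mat c (f a) := by
  simp [comp, ofInjective, Matrix.mul_apply]

theorem ofInjective_comp_mat (V : LocalIsometry A B) (f : B → C) (hf : Function.Injective f)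
    (h0 : f 0 = 0) (b : B) (a : A) :
    ((ofInjective f hf h0).comp V).mat (f b) a = V.mat b a := by
  simp [comp, ofInjective, Matrix.mul_apply, hf.eq_iff]

theorem ofInjective_comp_mat_of_notMem (V : LocalIsometry A B) (f : B → C)
    (hf : Function.Injective f) (h0 : f 0 = 0) {c : C} (hc : c ∉ Set.range f) (a : A) :
    ((ofInjective f hf h0).comp V).mat c a = 0 := by
  simp only [comp, ofInjective, Matrix.mul_apply, Matrix.of_apply, ite_mul, one_mul, zero_mul]
  exact Finset.sum_eq_zero fun b _ => if_neg fun h => hc ⟨b, h.symm⟩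

theorem ofInjective_comp_ofInjective (g : B → C) (hg : Function.Injective g) (hg0 : g 0 = 0)
    (f : A → B) (hf : Function.Injective f) (hf0 : f 0 = 0) :
    (ofInjective g hg hg0).comp (ofInjective f hf hf0) =
      ofInjective (g ∘ f) (hg.comp hf) (by simp [hf0, hg0]) := by
  ext c a
  rw [comp_ofInjective_mat]
  rfl

theorem tensor_ofInjective_ket (f : A → B) (hf : Function.Injective f) (h0 : f 0 = 0)
    (c : Config n A) : (ofInjective f hf h0).tensor n (ket c) = ket (c.mapRange f h0) := by
  classical
  ext d
  rw [tensor_ket, ket_apply]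
  split_ifs with h
  · exact finprod_eq_one_of_forall_eq_one fun x => by simp [ofInjective, h]
  · obtain ⟨x, hx⟩ := DFunLike.ne_iff.1 h
    exact finprod_eq_zero _ x (if_neg hx) (finite_mulSupport _ c d)

variable (A) in
/-- The identity, as a local isometry. -/
protected def id : LocalIsometry A A := ofInjective id Function.injective_id rfl

theorem comp_id (V : LocalIsometry A B) : V.comp (.id A) = V := by
  ext b a
  exact V.comp_ofInjective_mat _ _ _ _ _

theorem tensor_id : (LocalIsometry.id A).tensor n = ContinuousLinearMap.id ℂ (StateSpace n A) :=
  clm_ext_ket fun c => by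
    rw [LocalIsometry.id, tensor_ofInjective_ket, Finsupp.mapRange_id, ContinuousLinearMap.id_apply]

/-- A local isometry, as a linear isometry between Euclidean spaces. -/
def toLinearIsometry (V : LocalIsometry A B) : EuclideanSpace ℂ A →ₗᵢ[ℂ] EuclideanSpace ℂ B :=
  (Matrix.toEuclideanLin V.mat).isometryOfInner fun φ ψ => by
    rw [← LinearMap.adjoint_inner_right, ← Matrix.toEuclideanLin_conjTranspose_eq_adjoint,
      ← LinearMap.comp_apply, ← Matrix.toLpLin_mul_same, V.isometry, Matrix.toLpLin_one,
      LinearMap.id_apply]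

theorem toLinearIsometry_single (V : LocalIsometry A B) (a : A) (b : B) :
    V.toLinearIsometry (EuclideanSpace.single a 1) b = V.mat b a := by
  simp [toLinearIsometry, Matrix.toLpLin_apply]

/-- The local isometry of a linear isometry between Euclidean spaces that preserves `|0⟩`. -/
def ofLinearIsometry (f : EuclideanSpace ℂ A →ₗᵢ[ℂ] EuclideanSpace ℂ B)
    (h0 : f (EuclideanSpace.single 0 1) = EuclideanSpace.single 0 1) : LocalIsometry A B where
  mat := Matrix.of fun b a => f (EuclideanSpace.single a 1) b
  isometry := by
    ext a a'
    have h := f.inner_map_map (EuclideanSpace.single a 1) (EuclideanSpace.single a' 1)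
    rw [PiLp.inner_apply, EuclideanSpace.inner_single_left] at h
    simpa [Matrix.mul_apply, Matrix.one_apply, Pi.single_apply, mul_comm] using h
  quiescent := by
    ext b
    simp [h0, Pi.single_apply]

/-- The completion of a partial isometry to a unitary. -/
theorem exists_comp_eq (I J : LocalIsometry A B) : ∃ V : LocalIsometry B B, V.comp I = J := by
  let f := I.toLinearIsometry
  let L : LinearMap.range f.toLinearMap →ₗᵢ[ℂ] EuclideanSpace ℂ B :=
    J.toLinearIsometry.comp f.equivRange.symm.toLinearIsometry
  have hL : ∀ φ, L.extend (f φ) = J.toLinearIsometry φ := fun φ => by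
    rw [show f φ = (f.equivRange φ : EuclideanSpace ℂ B) from rfl, LinearIsometry.extend_apply]
    simp [L]
  have hsingle : ∀ V : LocalIsometry A B,
      V.toLinearIsometry (EuclideanSpace.single 0 1) = EuclideanSpace.single 0 1 := fun V => by
    ext b
    simp [toLinearIsometry_single, mat_zero]
  have h0 : L.extend (EuclideanSpace.single 0 1) = EuclideanSpace.single 0 1 := by
    rw [← hsingle I, hL, hsingle J, hsingle I]
  refine ⟨ofLinearIsometry L.extend h0, ?_⟩
  ext b a
  rw [← J.toLinearIsometry_single, ← hL,
    show f (EuclideanSpace.single a 1) = ∑ b', I.mat b' a • EuclideanSpace.single b' 1 by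
      ext b'
      simp [f, toLinearIsometry_single, Pi.single_apply],
    map_sum]
  simp [comp, ofLinearIsometry, Matrix.mul_apply, mul_comm]

/-- A scattering unitary from a quiescent isometry of the space of one hypercube. -/
def toScatteringUnitary (V : LocalIsometry (Block n 2 B) (Block n 2 B)) :
    ScatteringUnitary n B where
  mat := V.mat
  unitary := Matrix.mem_unitaryGroup_iff'.2 V.isometry
  quiescent := V.quiescent

/-- The tensor product `⨂ᵢ Vᵢ` of a finite family of local isometries. -/
def pi {ι : Type*} [Fintype ι] [DecidableEq ι] (V : ι → LocalIsometry A B) :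
    LocalIsometry (ι → A) (ι → B) where
  mat := Matrix.of fun b a => ∏ i, (V i).mat (b i) (a i)
  isometry := by
    ext a a'
    simp only [Matrix.mul_apply, Matrix.conjTranspose_apply, Matrix.of_apply, star_prod,
      ← Finset.prod_mul_distrib, Matrix.one_apply]
    rw [← Fintype.prod_sum fun i b => star ((V i).mat b (a i)) * (V i).mat b (a' i)]
    simp only [sum_conj_mat_mul_mat, ite_prod_eq]
  quiescent := by
    ext b
    simp only [Matrix.mulVec_single_one, Matrix.col_apply, Matrix.of_apply, Pi.zero_apply,
      mat_zero, Pi.single_apply]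
    exact ite_prod_eq b 0

/-- The local isometry that puts a letter in the `i`-th entry of an otherwise empty word. -/
def single (A : Type u) [Fintype A] [Zero A] [DecidableEq A] {ι : Type*} [Fintype ι]
    [DecidableEq ι] (i : ι) : LocalIsometry A (ι → A) :=
  ofInjective (Pi.single (M := fun _ => A) i) (Pi.single_injective i) (Pi.single_zero i)

theorem pi_comp_single {ι : Type*} [Fintype ι] [DecidableEq ι] (V : ι → LocalIsometry A B)
    (i : ι) : (pi V).comp (single A i) = (single B i).comp (V i) := by
  ext b a
  rw [single, comp_ofInjective_mat, single]
  by_cases hb : b ∈ Set.range (Pi.single (M := fun _ => B) i)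
  · obtain ⟨b, rfl⟩ := hb
    rw [ofInjective_comp_mat]
    refine (Finset.prod_eq_single i (fun j _ hj => ?_) (by simp)).trans (by simp)
    simp [hj, mat_zero]
  · rw [ofInjective_comp_mat_of_notMem _ _ _ _ hb]
    obtain ⟨j, hj⟩ := Function.ne_iff.1 fun h => hb ⟨b i, h.symm⟩
    have hji : j ≠ i := by
      rintro rfl
      simp at hj
    rw [Pi.single_eq_of_ne hji] at hj
    exact Finset.prod_eq_zero (Finset.mem_univ j) (by simp [hji, mat_zero, hj])

end LocalIsometry

/-! ### Steps of a PQCA as tensor products -/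

section Hypercubes

variable {n : ℕ} {A : Type u} [Zero A]

theorem shift_zero : shift (0 : Grid n) = Equiv.refl (Config n A) := by
  ext c x
  simp [shift_apply]

/-- The grouping of cells into the hypercubes on which a PQCA acts at time `t`. -/
def hypercubes (t : ℕ) : Config n A ≃ Config n (Block n 2 A) :=
  (shift fun _ => if Even t then 0 else 1).trans (group 2)

theorem hypercubes_of_even {t : ℕ} (ht : Even t) :
    (hypercubes t : Config n A ≃ Config n (Block n 2 A)) = group 2 := by
  simp only [hypercubes, ht, if_true]
  exact congrArg (Equiv.trans · (group 2)) shift_zero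

theorem hypercubes_of_odd {t : ℕ} (ht : ¬ Even t) :
    (hypercubes t : Config n A ≃ Config n (Block n 2 A)) =
      (shift fun _ => 1).trans (group 2) := by
  simp only [hypercubes, ht, if_false]

theorem ScatteringUnitary.step_eq [Fintype A] [DecidableEq A] (U : ScatteringUnitary n A) (t : ℕ) :
    U.step t = conjRelabel (hypercubes t).symm (U.toLocalIsometry.tensor n) := by
  by_cases ht : Even t
  · rw [hypercubes_of_even ht, step, if_pos ht, J]
  · rw [hypercubes_of_odd ht, step, if_neg ht]
    rfl

end Hypercubes

section Encode

variable {P : Type v} {n : ℕ} {A : Type u} [Zero A] [Fintype A] [DecidableEq A]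
  {B : Type w} [Fintype B] [Zero B] [DecidableEq B]

/-- The encoding of configurations `P`, seen as configurations of blocks through `blk`, that writes
each block by means of `I` into a hypercube of time `t`. -/
def encode (blk : P ≃ Config n A) (I : LocalIsometry A (Block n 2 B)) (t : ℕ) :
    L2 P →L[ℂ] StateSpace n B :=
  (relabel (hypercubes (n := n) (A := B) t).symm :
      StateSpace n (Block n 2 B) →L[ℂ] StateSpace n B) ∘L I.tensor n ∘L
    (relabel blk : L2 P →L[ℂ] StateSpace n A)

theorem encode_congr_of_even (blk : P ≃ Config n A) (I : LocalIsometry A (Block n 2 B)) {t t' : ℕ}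
    (ht : Even t) (ht' : Even t') : encode blk I t = encode blk I t' := by
  rw [encode, encode, hypercubes_of_even ht, hypercubes_of_even ht']

theorem encode_ofInjective_ket (blk : P ≃ Config n A) (f : A → Block n 2 B)
    (hf : Function.Injective f) (h0 : f 0 = 0) (t : ℕ) (p : P) :
    encode blk (.ofInjective f hf h0) t (ket p) =
      ket ((hypercubes t).symm ((blk p).mapRange f h0)) := by
  change relabel _ ((LocalIsometry.ofInjective f hf h0).tensor n (relabel blk (ket p))) = _
  rw [relabel_ket, LocalIsometry.tensor_ofInjective_ket, relabel_ket]

theorem LocalIsometry.step_comp_encode {V : LocalIsometry (Block n 2 B) (Block n 2 B)}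
    {W : LocalIsometry A A} {I J : LocalIsometry A (Block n 2 B)} (h : V.comp I = J.comp W)
    (blk : P ≃ Config n A) (t : ℕ) :
    V.toScatteringUnitary.step t ∘L encode blk I t =
      encode blk J t ∘L conjRelabel blk.symm (W.tensor n) := by
  have key : V.tensor n ∘L I.tensor n = J.tensor n ∘L W.tensor n := by
    rw [← tensor_comp, h, tensor_comp]
  ext1 φ
  rw [ScatteringUnitary.step_eq]
  change relabel (hypercubes t).symm (V.tensor n ((relabel (hypercubes t).symm).symm
      (relabel (hypercubes t).symm (I.tensor n (relabel blk φ))))) =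
    relabel (hypercubes t).symm (J.tensor n (relabel blk (relabel blk.symm
      (W.tensor n (relabel blk φ)))))
  rw [LinearIsometryEquiv.symm_apply_apply]
  change relabel _ ((V.tensor n ∘L I.tensor n) _) =
    relabel _ (J.tensor n (relabel blk ((relabel blk).symm _)))
  rw [key, LinearIsometryEquiv.apply_symm_apply]
  rfl

end Encode

/-! ### Time-dependent scattering unitaries -/

section Tracks

open LocalIsometry

variable {n k : ℕ} [NeZero k] {D : Type u} [Fintype D] [Zero D] [DecidableEq D]

/-- The local isometry that writes a hypercube over `D` on track `t` of a hypercube whose cells have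
`k` tracks. -/
def track (t : ZMod k) : LocalIsometry (Block n 2 D) (Block n 2 (ZMod k → D)) :=
  ofInjective (fun w o => Pi.single t (w o))
    (Pi.single_injective (M := fun _ : ZMod k => D) t).comp_left
    (funext fun _ => Pi.single_zero t)

/-- The isometry that applies `V t` to each track `t`, and then moves the contents of each track to
the next one: the content of a single track undergoes `V 0`, `V 1`, … in turn. -/
def multiplex (V : ZMod k → LocalIsometry (Block n 2 D) (Block n 2 D)) :
    LocalIsometry (Block n 2 (ZMod k → D)) (Block n 2 (ZMod k → D)) :=
  (ofInjective (fun f o t => f (t - 1) o)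
    (Function.LeftInverse.injective (g := fun g t o => g o (t + 1)) fun f => by simp) rfl).comp
  ((pi V).comp (ofInjective Function.swap Function.swap_bijective.injective rfl))

theorem multiplex_comp_track (V : ZMod k → LocalIsometry (Block n 2 D) (Block n 2 D))
    (t : ZMod k) : (multiplex V).comp (track t) = (track (t + 1)).comp (V t) := by
  have hswap : (ofInjective Function.swap Function.swap_bijective.injective rfl).comp (track t) =
      single (Block n 2 D) t := by
    rw [track, ofInjective_comp_ofInjective, single]
    congr 1
    funext w t' o
    by_cases h : t' = t <;> simp [Function.swap, h]
  rw [multiplex, comp_assoc, comp_assoc, hswap, pi_comp_single, ← comp_assoc, single,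
    ofInjective_comp_ofInjective, track]
  congr 2
  funext w o t'
  by_cases h : t' = t + 1 <;> simp [sub_eq_iff_eq_add, h]

theorem encode_track_comp {P : Type v} {A : Type w} [Fintype A] [Zero A] [DecidableEq A]
    (blk : P ≃ Config n A) (t : ZMod k) (I : LocalIsometry A (Block n 2 D)) (t' : ℕ) :
    encode blk ((track t).comp I) t' = (single D t).tensor n ∘L encode blk I t' := by
  have key : (relabel (hypercubes (n := n) (A := ZMod k → D) t').symm :
        StateSpace n (Block n 2 (ZMod k → D)) →L[ℂ] StateSpace n (ZMod k → D)) ∘L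
      (track t).tensor n = (single D t).tensor n ∘L
        (relabel (hypercubes (n := n) (A := D) t').symm :
          StateSpace n (Block n 2 D) →L[ℂ] StateSpace n D) := by
    refine clm_ext_ket fun d => ?_
    change relabel _ ((track t).tensor n (ket d)) =
      (single D t).tensor n (relabel (hypercubes (n := n) (A := D) t').symm (ket d))
    rw [relabel_ket, track, single, tensor_ofInjective_ket, tensor_ofInjective_ket, relabel_ket]
    exact congrArg ket (Finsupp.ext fun _ => rfl)
  rw [encode, tensor_comp, ContinuousLinearMap.comp_assoc, ← ContinuousLinearMap.comp_assoc, key]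
  rfl

end Tracks

/-! ### Distributing a supercell over the cells of a hypercube -/

section Split

open LocalIsometry

variable {n L : ℕ} {Q : Type u}

/-- An offset within a supercell, as a vector of the grid. -/
def toGrid (c : Fin n → Fin L) : Grid n := fun i => ((c i : ℕ) : ℤ)

theorem two_mul_add_fin_two_add_one_ediv (a : ℤ) (o : Fin 2) :
    (2 * a + (o : ℕ) + 1) / 2 = a + (o : ℕ) := by
  have := o.2
  omega

theorem two_mul_add_fin_two_add_one_emod (a : ℤ) (o : Fin 2) :
    (2 * a + (o : ℕ) + 1) % 2 = 1 - (o : ℕ) := by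
  have := o.2
  omega

theorem offsetOf_cellAt_add_one_eq_iff (x : Grid n) (o : Fin n → Fin 2) (P : Fin n → Prop)
    [DecidablePred P] :
    (offsetOf 2 (cellAt 2 x o + fun _ => 1) = fun i => if P i then 0 else 1) ↔
      o = fun i => if P i then 1 else 0 := by
  rw [funext_iff, funext_iff]
  refine forall_congr' fun i => ?_
  have ho := (o i).2
  simp only [offsetOf, cellAt, Pi.add_apply, Fin.ext_iff, Nat.cast_ofNat,
    two_mul_add_fin_two_add_one_emod]
  split_ifs <;> simp <;> omega

theorem cellAt_supercellOf_cellAt_add_one (c p : Fin n → Fin L) (x : Grid n) :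
    cellAt L (supercellOf 2 (cellAt 2 x (fun i => if p i < c i then 1 else 0) + fun _ => 1)) p =
      cellAt L x (p - c) + toGrid c := by
  funext i
  simp only [cellAt, supercellOf, Pi.add_apply, toGrid, Pi.sub_apply, Nat.cast_ofNat,
    two_mul_add_fin_two_add_one_ediv]
  have hc := (c i).2
  rcases lt_or_ge (p i) (c i) with hlt | hge
  · have := Fin.lt_def.1 hlt
    rw [Fin.coe_sub_iff_lt.2 hlt, if_pos hlt, Nat.cast_sub (by omega)]
    push_cast [Fin.val_one]
    ring
  · rw [Fin.coe_sub_iff_le.2 hge, if_neg (not_lt.2 hge), Nat.cast_sub (Fin.le_def.1 hge)]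
    push_cast [Fin.val_zero]
    ring

variable [NeZero L] [Zero Q]

/-- Grouping cells into supercells after a translation by `c`. -/
def groupAt (c : Fin n → Fin L) : Config n Q ≃ Config n (Block n L Q) :=
  (shift (toGrid c)).trans (group L)

variable [Fintype Q] [DecidableEq Q]

/-- The isometry that distributes a supercell over a hypercube of time `0`: the letter `p` goes to
the last cell, moved backwards by one along those coordinates `i` for which `p i < c i`. The
hypercubes of time `1` then contain the windows of cells offset by `c`. -/
def splitEven (c : Fin n → Fin L) : LocalIsometry (Block n L Q) (Block n 2 (Block n L Q)) :=
  ofInjective (fun w o p => if o = (fun i => if p i < c i then 0 else 1) then w p else 0)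
    (Function.LeftInverse.injective
      (g := fun g p => g (fun i => if p i < c i then 0 else 1) p) fun w => by simp)
    (by ext; simp)

/-- The isometry that distributes a window of cells offset by `c` over a hypercube of time `1`, in
agreement with `splitEven c`. -/
def splitOdd (c : Fin n → Fin L) : LocalIsometry (Block n L Q) (Block n 2 (Block n L Q)) :=
  ofInjective (fun w o p => if o = (fun i => if p i < c i then 1 else 0) then w (p - c) else 0)
    (Function.LeftInverse.injective
      (g := fun g p => g (fun i => if (p + c) i < c i then 1 else 0) (p + c)) fun w => by simp)
    (by ext; simp)

theorem encode_splitEven (c : Fin n → Fin L) {t t' : ℕ} (ht : Even t) (ht' : ¬ Even t') :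
    encode (group L : Config n Q ≃ _) (splitEven c) t = encode (groupAt c) (splitOdd c) t' := by
  refine clm_ext_ket fun q => ?_
  rw [splitEven, splitOdd, encode_ofInjective_ket, encode_ofInjective_ket, hypercubes_of_even ht,
    hypercubes_of_odd ht']
  congr 1
  rw [Equiv.eq_symm_apply]
  ext x o p
  change (if offsetOf 2 (cellAt 2 x o + fun _ => 1) = (fun i => if p i < c i then 0 else 1) then
      q (cellAt L (supercellOf 2 (cellAt 2 x o + fun _ => 1)) p) else 0) =
    if o = (fun i => if p i < c i then 1 else 0) then q (cellAt L x (p - c) + toGrid c) else 0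
  rw [if_congr (offsetOf_cellAt_add_one_eq_iff x o fun i => p i < c i) rfl rfl]
  refine ite_congr rfl (fun ho => ?_) fun _ => rfl
  rw [ho, cellAt_supercellOf_cellAt_add_one]

end Split

/-! ### Circuits of translated block gates -/

section Circuit

open LocalIsometry

variable {n L : ℕ} [NeZero L] {Q : Type u} [Fintype Q] [Zero Q] [DecidableEq Q]

/-- The operator that applies the gate `W` to each of the windows of cells `L x + c + {0, …,
L-1}ⁿ`. -/
def gateAt (c : Fin n → Fin L) (W : LocalIsometry (Block n L Q) (Block n L Q)) : Op n Q :=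
  conjRelabel (groupAt c).symm (W.tensor n)

/-- The operator of the first gates of a sequence, the gate `a` being applied at offset `c (a + 1)`:
the offset `c 0` is the one from which the data has to be moved before the first gate. -/
def circuit (c : ℕ → Fin n → Fin L) (W : ℕ → LocalIsometry (Block n L Q) (Block n L Q)) :
    ℕ → Op n Q
  | 0 => ContinuousLinearMap.id ℂ _
  | a + 1 => gateAt (c (a + 1)) (W a) ∘L circuit c W a

theorem conjRelabel_id {X Y : Type*} (e : X ≃ Y) :
    conjRelabel e (ContinuousLinearMap.id ℂ (L2 X)) = ContinuousLinearMap.id ℂ (L2 Y) := by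
  ext1 φ
  exact (relabel e).apply_symm_apply φ

theorem exists_schedule (c : ℕ → Fin n → Fin L)
    (W : ℕ → LocalIsometry (Block n L Q) (Block n L Q)) :
    ∃ V : ℕ → LocalIsometry (Block n 2 (Block n L Q)) (Block n 2 (Block n L Q)), ∀ a,
      (V (2 * a)).comp (splitEven (c a)) = splitEven (c (a + 1)) ∧
        (V (2 * a + 1)).comp (splitOdd (c (a + 1))) = (splitOdd (c (a + 1))).comp (W a) := by
  choose V hV using fun a => exists_comp_eq (splitEven (Q := Q) (c a)) (splitEven (c (a + 1)))
  choose V' hV' using fun a =>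
    exists_comp_eq (splitOdd (c (a + 1))) ((splitOdd (c (a + 1))).comp (W a))
  refine ⟨fun t => if Even t then V (t / 2) else V' (t / 2), fun a => ⟨?_, ?_⟩⟩
  · simpa using hV a
  · simpa [show (2 * a + 1) / 2 = a by omega] using hV' a

variable {k : ℕ} [NeZero k]

theorem multiplex_step_step {V : ZMod k → LocalIsometry (Block n 2 (Block n L Q)) _} {τ : ZMod k}
    {c c' : Fin n → Fin L} {W : LocalIsometry (Block n L Q) (Block n L Q)}
    (hV : (V τ).comp (splitEven c) = splitEven c')
    (hV' : (V (τ + 1)).comp (splitOdd c') = (splitOdd c').comp W) {t : ℕ} (ht : Even t) :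
    ((multiplex V).toScatteringUnitary.step (t + 1) ∘L (multiplex V).toScatteringUnitary.step t) ∘L
      encode (group L : Config n Q ≃ _) ((track τ).comp (splitEven c)) 0 =
    encode (group L) ((track (τ + 1 + 1)).comp (splitEven c')) 0 ∘L gateAt c' W := by
  have ht' : ¬ Even (t + 1) := Nat.not_even_iff_odd.2 ht.add_one
  have hmove : (multiplex V).comp ((track τ).comp (splitEven c)) =
      ((track (τ + 1)).comp (splitEven c')).comp (.id _) := by
    rw [← comp_assoc, multiplex_comp_track, comp_assoc, hV, comp_id]
  have hgate : (multiplex V).comp ((track (τ + 1)).comp (splitOdd c')) =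
      ((track (τ + 1 + 1)).comp (splitOdd c')).comp W := by
    rw [← comp_assoc, multiplex_comp_track, comp_assoc, hV', comp_assoc]
  have hregroup : ∀ σ : ZMod k,
      encode (group L : Config n Q ≃ _) ((track σ).comp (splitEven c')) t =
        encode (groupAt c') ((track σ).comp (splitOdd c')) (t + 1) := fun σ => by
    rw [encode_track_comp, encode_splitEven c' ht ht', encode_track_comp]
  rw [encode_congr_of_even _ _ Even.zero ht, encode_congr_of_even _ _ Even.zero ht,
    ContinuousLinearMap.comp_assoc, step_comp_encode hmove, tensor_id, conjRelabel_id,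
    ContinuousLinearMap.comp_id, hregroup, step_comp_encode hgate, hregroup, gateAt]

theorem exists_evolution_comp_encode (c : ℕ → Fin n → Fin L)
    (W : ℕ → LocalIsometry (Block n L Q) (Block n L Q)) {m : ℕ} [NeZero m] (hc : c m = c 0) :
    ∃ U : ScatteringUnitary n (ZMod (2 * m) → Block n L Q),
      U.evolution (2 * m) ∘L encode (group L) ((track 0).comp (splitEven (c 0))) 0 =
        encode (group L) ((track 0).comp (splitEven (c 0))) 0 ∘L circuit c W m := by
  obtain ⟨V, hV⟩ := exists_schedule c W
  let V' : ZMod (2 * m) → LocalIsometry (Block n 2 (Block n L Q)) (Block n 2 (Block n L Q)) :=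
    fun τ => V τ.val
  refine ⟨(multiplex V').toScatteringUnitary, ?_⟩
  have main : ∀ a ≤ m, (multiplex V').toScatteringUnitary.evolution (2 * a) ∘L
      encode (group L) ((track 0).comp (splitEven (c 0))) 0 =
        encode (group L) ((track ((2 * a : ℕ) : ZMod (2 * m))).comp (splitEven (c a))) 0 ∘L
          circuit c W a := by
    intro a
    induction a with
    | zero =>
      intro _
      rw [mul_zero, Nat.cast_zero]
      rfl
    | succ a ih =>
      intro ha
      have hV₀ : (V' (2 * a : ℕ)).comp (splitEven (c a)) = splitEven (c (a + 1)) := by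
        simpa only [V', ZMod.val_cast_of_lt (show 2 * a < 2 * m by omega)] using (hV a).1
      have hV₁ : (V' ((2 * a : ℕ) + 1)).comp (splitOdd (c (a + 1))) =
          (splitOdd (c (a + 1))).comp (W a) := by
        simpa only [V', ← Nat.cast_succ,
          ZMod.val_cast_of_lt (show 2 * a + 1 < 2 * m by omega)] using (hV a).2
      have hstep := multiplex_step_step hV₀ hV₁ (even_two_mul a)
      rw [show ((2 * (a + 1) : ℕ) : ZMod (2 * m)) = (2 * a : ℕ) + 1 + 1 by push_cast; ring, circuit,
        ← ContinuousLinearMap.comp_assoc, ← hstep, ContinuousLinearMap.comp_assoc, ← ih (by omega)]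
      rfl
  rw [main m le_rfl, ZMod.natCast_self, hc]

end Circuit

/-! ### Causality in the Heisenberg picture -/

section Heisenberg

variable {H : Type*} [NormedAddCommGroup H] [InnerProductSpace ℂ H] [CompleteSpace H]
  {G : H →L[ℂ] H}

/-- The observable `G† T G`: the expectation of `T` after the evolution `G`, as an observable on the
state before it. -/
def heisenberg (G T : H →L[ℂ] H) : H →L[ℂ] H := G.adjoint ∘L T ∘L G

theorem inner_heisenberg (G T : H →L[ℂ] H) (ψ φ : H) :
    inner ℂ ψ (heisenberg G T φ) = inner ℂ (G ψ) (T (G φ)) := by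
  rw [heisenberg, ContinuousLinearMap.comp_apply, ContinuousLinearMap.adjoint_inner_right,
    ContinuousLinearMap.comp_apply]

theorem comp_adjoint_of_mem_unitary (hG : G ∈ unitary (H →L[ℂ] H)) :
    G ∘L G.adjoint = ContinuousLinearMap.id ℂ H := by
  rw [← ContinuousLinearMap.star_eq_adjoint]
  exact (Unitary.mem_iff.1 hG).2

theorem adjoint_comp_of_mem_unitary (hG : G ∈ unitary (H →L[ℂ] H)) :
    G.adjoint ∘L G = ContinuousLinearMap.id ℂ H := by
  rw [← ContinuousLinearMap.star_eq_adjoint]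
  exact (Unitary.mem_iff.1 hG).1

theorem heisenberg_id (hG : G ∈ unitary (H →L[ℂ] H)) :
    heisenberg G (ContinuousLinearMap.id ℂ H) =
      ContinuousLinearMap.id ℂ H := by
  rw [heisenberg, ContinuousLinearMap.id_comp, adjoint_comp_of_mem_unitary hG]

theorem heisenberg_comp (hG : G ∈ unitary (H →L[ℂ] H)) (S T : H →L[ℂ] H) :
    heisenberg G (S ∘L T) = heisenberg G S ∘L heisenberg G T := by
  simp only [heisenberg, ContinuousLinearMap.comp_assoc]
  rw [← ContinuousLinearMap.comp_assoc G G.adjoint, comp_adjoint_of_mem_unitary hG,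
    ContinuousLinearMap.id_comp]

theorem adjoint_heisenberg (G T : H →L[ℂ] H) :
    (heisenberg G T).adjoint = heisenberg G T.adjoint := by
  simp only [heisenberg, ContinuousLinearMap.adjoint_comp, ContinuousLinearMap.adjoint_adjoint,
    ContinuousLinearMap.comp_assoc]

theorem comp_heisenberg (hG : G ∈ unitary (H →L[ℂ] H)) (T : H →L[ℂ] H) :
    G ∘L heisenberg G T = T ∘L G := by
  rw [heisenberg, ← ContinuousLinearMap.comp_assoc, comp_adjoint_of_mem_unitary hG,
    ContinuousLinearMap.id_comp]

theorem heisenberg_smul {z : ℂ} (hz : ‖z‖ = 1) (G T : H →L[ℂ] H) :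
    heisenberg (z • G) T = heisenberg G T := by
  have hzz : z * starRingEnd ℂ z = 1 := by
    rw [Complex.mul_conj, Complex.normSq_eq_norm_sq, hz, one_pow, Complex.ofReal_one]
  ext1 φ
  simp only [heisenberg, map_smulₛₗ, ContinuousLinearMap.comp_apply, smul_apply,
    smul_smul, hzz, one_smul, RingHom.id_apply]

end Heisenberg

section SignFlip

variable {X : Type u}

open Classical in
theorem orthonormal_sign_smul_ket (s : Set X) :
    Orthonormal ℂ fun x => (if x ∈ s then -1 else 1 : ℂ) • (ket x : L2 X) := by
  refine ⟨fun x => ?_, fun x y hxy => ?_⟩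
  · dsimp only
    split_ifs <;> simp [norm_ket]
  · dsimp only
    rw [inner_smul_left, inner_smul_right, orthonormal_ket.2 hxy, mul_zero, mul_zero]

/-- The isometry that changes the sign of the basis vectors in `s`. -/
def signFlip (s : Set X) : L2 X →ₗᵢ[ℂ] L2 X := ofOrthonormal (orthonormal_sign_smul_ket s)

open Classical in
theorem signFlip_ket (s : Set X) (x : X) :
    signFlip s (ket x) = (if x ∈ s then -1 else 1 : ℂ) • ket x :=
  ofOrthonormal_ket (orthonormal_sign_smul_ket s) x

open Classical in
theorem signFlip_apply (s : Set X) (φ : L2 X) (x : X) :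
    signFlip s φ x = (if x ∈ s then -1 else 1 : ℂ) * φ x := by
  rw [← inner_ket_left x φ, ← (signFlip s).inner_map_map (ket x), signFlip_ket, inner_smul_left,
    inner_ket_left]
  split_ifs <;> simp

end SignFlip

section Reduced

variable {n : ℕ} {A : Type u} [Zero A]

theorem glue_of_mem {S : Finset (Grid n)} (a : S → A) (e : Config n A) {x : Grid n} (h : x ∈ S) :
    glue S a e x = a ⟨x, h⟩ := by
  simp [glue, h]

theorem glue_of_notMem {S : Finset (Grid n)} (a : S → A) (e : Config n A) {x : Grid n}
    (h : x ∉ S) : glue S a e x = e x := by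
  simp [glue, h]

open Classical in
/-- The decomposition of configurations into their part on `S` and their part on the complement. -/
def glueEquiv (S : Finset (Grid n)) :
    (S → A) × {e : Config n A // ∀ x ∈ S, e x = 0} ≃ Config n A where
  toFun p := glue S p.1 p.2
  invFun c := (fun x => c x, ⟨c.filter (· ∉ S), fun x hx => by simp [hx]⟩)
  left_inv := by
    rintro ⟨a, e, he⟩
    refine Prod.ext (funext fun x => glue_of_mem a e x.2) (Subtype.ext (Finsupp.ext fun x => ?_))
    by_cases hx : x ∈ S
    · simp [hx, he x hx]
    · simp [hx, glue_of_notMem a e hx]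
  right_inv c := by
    ext x
    by_cases hx : x ∈ S
    · simp [glue_of_mem _ _ hx]
    · simp [glue_of_notMem _ _ hx, hx]

theorem eq_of_glue_eq_on {S : Finset (Grid n)} {a b : S → A} {e f : Config n A}
    (h : ∀ x ∈ S, glue S a e x = glue S b f x) : a = b := by
  funext x
  simpa only [glue_of_mem _ _ x.2] using h x x.2

theorem eq_of_glue_eq_off {S : Finset (Grid n)} {a b : S → A}
    {e f : {e : Config n A // ∀ x ∈ S, e x = 0}}
    (h : ∀ x ∉ S, glue S a e.1 x = glue S b f.1 x) : e = f := by
  refine Subtype.ext (Finsupp.ext fun x => ?_)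
  by_cases hx : x ∈ S
  · rw [e.2 x hx, f.2 x hx]
  · simpa only [glue_of_notMem _ _ hx] using h x hx

/-- The configurations that coincide with `a` on `S`, seen as configurations of the complement. -/
def glueEmb (S : Finset (Grid n)) (a : S → A) :
    {e : Config n A // ∀ x ∈ S, e x = 0} ↪ Config n A :=
  (Function.Embedding.sectR a _).trans (glueEquiv S).toEmbedding

theorem glueEmb_apply (S : Finset (Grid n)) (a : S → A) (e) : glueEmb S a e = glue S a e.1 := rfl

/-- The permutation of configurations that applies `σ` to their part on the complement of `S`. -/
def complementPerm (S : Finset (Grid n)) (σ : Equiv.Perm {e : Config n A // ∀ x ∈ S, e x = 0}) :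
    Equiv.Perm (Config n A) :=
  (glueEquiv S).permCongr ((Equiv.refl _).prodCongr σ)

theorem complementPerm_glueEquiv (S : Finset (Grid n))
    (σ : Equiv.Perm {e : Config n A // ∀ x ∈ S, e x = 0}) (a : S → A) (e) :
    complementPerm S σ (glueEquiv S (a, e)) = glueEquiv S (a, σ e) := by
  simp [complementPerm, Equiv.permCongr_apply]

/-- The partial inner product `⟨a|φ` with the basis vector `|a⟩` of the cells `S`. -/
def partialBra (S : Finset (Grid n)) (a : S → A) :
    StateSpace n A →L[ℂ] L2 {e : Config n A // ∀ x ∈ S, e x = 0} :=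
  restrict (glueEmb S a)

theorem partialBra_relabel_complementPerm (S : Finset (Grid n)) (a : S → A)
    (σ : Equiv.Perm {e : Config n A // ∀ x ∈ S, e x = 0}) (ψ : StateSpace n A) :
    partialBra S a (relabel (complementPerm S σ) ψ) = relabel σ (partialBra S a ψ) := by
  ext e
  rw [partialBra, restrict_apply, relabel_apply, relabel_apply, restrict_apply]
  refine congrArg ψ ((Equiv.symm_apply_eq _).2 ?_)
  change glueEquiv S (a, e) = complementPerm S σ (glueEquiv S (a, σ.symm e))
  rw [complementPerm_glueEquiv, Equiv.apply_symm_apply]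

theorem reduced_rankOne (S : Finset (Grid n)) (ψ : StateSpace n A) (a b : S → A) :
    reduced S (InnerProductSpace.rankOne ℂ ψ ψ) a b =
      inner ℂ (partialBra S b ψ) (partialBra S a ψ) := by
  rw [lp.inner_eq_tsum, reduced]
  refine tsum_congr fun e => ?_
  rw [InnerProductSpace.rankOne_apply, inner_smul_right, inner_ket_left, ← inner_conj_symm,
    inner_ket_left]
  simp [partialBra, glueEmb_apply, mul_comm]

theorem isDensity_rankOne {ψ : StateSpace n A} (hψ : ‖ψ‖ = 1) :
    IsDensity (InnerProductSpace.rankOne ℂ ψ ψ) := by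
  refine ⟨InnerProductSpace.isPositive_rankOne_self ψ, ?_⟩
  have h := lp.hasSum_inner (𝕜 := ℂ) ψ ψ
  rw [inner_self_eq_norm_sq_to_K, hψ, RCLike.ofReal_one, one_pow] at h
  refine h.congr_fun fun c => ?_
  rw [InnerProductSpace.rankOne_apply, inner_smul_right, inner_ket_left, ← inner_conj_symm,
    inner_ket_left, RCLike.inner_apply, mul_comm]

theorem conj_rankOne (G : Op n A) (ψ : StateSpace n A) :
    G ∘L InnerProductSpace.rankOne ℂ ψ ψ ∘L G.adjoint =
      InnerProductSpace.rankOne ℂ (G ψ) (G ψ) := by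
  ext1 φ
  simp [InnerProductSpace.rankOne_apply, ContinuousLinearMap.adjoint_inner_right]

/-- The matrix unit `|u⟩⟨v|` of the cell `x`. -/
def matUnit (x : Grid n) (u v : A) : Op n A :=
  embed (glueEmb {x} fun _ => u) ∘L partialBra {x} fun _ => v

theorem inner_matUnit (x : Grid n) (u v : A) (ψ φ : StateSpace n A) :
    inner ℂ ψ (matUnit x u v φ) =
      inner ℂ (partialBra {x} (fun _ => u) ψ) (partialBra {x} (fun _ => v) φ) := by
  rw [matUnit, ContinuousLinearMap.comp_apply, ← ContinuousLinearMap.adjoint_inner_left]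
  rfl

theorem CausalWith.inner_heisenberg_matUnit_self {N : Finset (Grid n)} {G : Op n A}
    (hG : CausalWith N G) (x : Grid n) (u v : A) {ψ φ : StateSpace n A} (hn : ‖ψ‖ = ‖φ‖)
    (h : ∀ a b, inner ℂ (partialBra (N.map (addLeftEmbedding x)) b ψ) (partialBra _ a ψ) =
      inner ℂ (partialBra (N.map (addLeftEmbedding x)) b φ) (partialBra _ a φ)) :
    inner ℂ ψ (heisenberg G (matUnit x u v) ψ) = inner ℂ φ (heisenberg G (matUnit x u v) φ) := by
  by_cases h0 : ‖ψ‖ = 0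
  · rw [norm_eq_zero.1 h0, norm_eq_zero.1 (hn.symm.trans h0)]
  set r : ℂ := ((‖ψ‖⁻¹ : ℝ) : ℂ) with hr
  have hr0 : r ≠ 0 := by simpa [hr] using h0
  obtain ⟨f, hf⟩ := hG x
  have hψ := hf _ (isDensity_rankOne (ψ := r • ψ) (by simp [hr, norm_smul, h0]))
  have hφ := hf _ (isDensity_rankOne (ψ := r • φ) (by simp [hr, norm_smul, ← hn, h0]))
  have hred : reduced (N.map (addLeftEmbedding x)) (InnerProductSpace.rankOne ℂ (r • ψ) (r • ψ)) =
      reduced (N.map (addLeftEmbedding x)) (InnerProductSpace.rankOne ℂ (r • φ) (r • φ)) := by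
    ext a b
    rw [reduced_rankOne, reduced_rankOne]
    simp only [map_smul, inner_smul_left, inner_smul_right, h]
  rw [hred, ← hφ, conj_rankOne, conj_rankOne] at hψ
  have hvu := congrFun₂ hψ (fun _ => v) fun _ => u
  rw [reduced_rankOne, reduced_rankOne] at hvu
  simp only [map_smul, inner_smul_left, inner_smul_right, ← inner_matUnit,
    ← inner_heisenberg] at hvu
  exact mul_left_cancel₀ (by simpa using hr0) (mul_left_cancel₀ hr0 hvu)

theorem CausalWith.inner_heisenberg_matUnit {N : Finset (Grid n)} {G : Op n A}
    (hG : CausalWith N G) (x : Grid n) (u v : A) (D : StateSpace n A →ₗᵢ[ℂ] StateSpace n A)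
    (hD : ∀ ψ a b,
      inner ℂ (partialBra (N.map (addLeftEmbedding x)) b (D ψ)) (partialBra _ a (D ψ)) =
        inner ℂ (partialBra (N.map (addLeftEmbedding x)) b ψ) (partialBra _ a ψ))
    (ψ φ : StateSpace n A) :
    inner ℂ (D ψ) (heisenberg G (matUnit x u v) (D φ)) =
      inner ℂ ψ (heisenberg G (matUnit x u v) φ) := by
  have hself := (ext_inner_map ((heisenberg D.toContinuousLinearMap
      (heisenberg G (matUnit x u v))).toLinearMap)
    (heisenberg G (matUnit x u v)).toLinearMap).1 fun ψ => by
      rw [← inner_conj_symm, ← inner_conj_symm (_ : StateSpace n A) ψ]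
      exact congrArg _ ((inner_heisenberg _ _ _ _).trans
        (hG.inner_heisenberg_matUnit_self x u v (D.norm_map ψ) (hD ψ)))
  rw [← LinearIsometry.coe_toContinuousLinearMap, ← inner_heisenberg]
  exact congrArg (inner ℂ ψ) (LinearMap.congr_fun hself φ)

/-- The operator `T` is of the form `T' ⊗ 1` with `T'` acting on the cells `S`. -/
structure IsLocalOn (S : Set (Grid n)) (T : Op n A) : Prop where
  eq_zero : ∀ c c' x, x ∉ S → c x ≠ c' x → T (ket c') c = 0
  congr : ∀ c c' d d', (∀ x ∉ S, c x = c' x) → (∀ x ∉ S, d x = d' x) →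
    (∀ x ∈ S, c x = d x) → (∀ x ∈ S, c' x = d' x) → T (ket c') c = T (ket d') d

theorem IsLocalOn.mono {S S' : Set (Grid n)} {T : Op n A} (h : IsLocalOn S T) (hS : S ⊆ S') :
    IsLocalOn S' T := by
  refine ⟨fun c c' x hx => h.eq_zero c c' x fun hx' => hx (hS hx'), ?_⟩
  intro c c' d d' hc hd hcd hcd'
  by_cases hcc' : ∀ x ∉ S, c x = c' x
  · refine h.congr _ _ _ _ hcc' (fun x hx => ?_) (fun x hx => hcd x (hS hx))
      fun x hx => hcd' x (hS hx)
    by_cases hx' : x ∈ S'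
    · rw [← hcd x hx', ← hcd' x hx', hcc' x hx]
    · exact hd x hx'
  · push Not at hcc'
    obtain ⟨x, hx, hne⟩ := hcc'
    have hx' : x ∈ S' := not_not.1 fun hx' => hne (hc x hx')
    rw [h.eq_zero _ _ x hx hne, h.eq_zero d d' x hx (by rwa [← hcd x hx', ← hcd' x hx'])]

theorem CausalWith.isLocalOn {N : Finset (Grid n)} {G : Op n A} (hG : CausalWith N G)
    (x : Grid n) (u v : A) :
    IsLocalOn (N.map (addLeftEmbedding x) : Finset (Grid n)) (heisenberg G (matUnit x u v)) := by
  classical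
  have hinner := hG.inner_heisenberg_matUnit x u v
  set S := N.map (addLeftEmbedding x)
  constructor
  · intro c c' y hy hne
    have key := hinner (signFlip {d | d y = c y}) (fun ψ a b => by
      rw [lp.inner_eq_tsum, lp.inner_eq_tsum]
      refine tsum_congr fun e => ?_
      simp only [partialBra, restrict_apply, signFlip_apply, Set.mem_ofPred_eq, glueEmb_apply,
        glue_of_notMem _ _ hy]
      split_ifs <;> simp) (ket c) (ket c')
    simp only [signFlip_ket, Set.mem_ofPred_eq, if_true, if_neg hne.symm, one_smul, neg_smul,
      inner_neg_left, inner_ket_left] at key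
    exact self_eq_neg.1 key.symm
  · intro c c' d d' hc hd hcd hcd'
    obtain ⟨⟨a, e⟩, rfl⟩ := (glueEquiv S).surjective c
    obtain ⟨⟨b, e'⟩, rfl⟩ := (glueEquiv S).surjective c'
    obtain ⟨⟨a', f⟩, rfl⟩ := (glueEquiv S).surjective d
    obtain ⟨⟨b', f'⟩, rfl⟩ := (glueEquiv S).surjective d'
    obtain rfl : e = e' := eq_of_glue_eq_off hc
    obtain rfl : f = f' := eq_of_glue_eq_off hd
    obtain rfl : a = a' := eq_of_glue_eq_on hcd
    obtain rfl : b = b' := eq_of_glue_eq_on hcd'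
    have key := hinner (relabel (complementPerm S (Equiv.swap e f))).toLinearIsometry
      (fun ψ a b => by
      change inner ℂ (partialBra S b (relabel _ ψ)) (partialBra S a (relabel _ ψ)) = _
      rw [partialBra_relabel_complementPerm, partialBra_relabel_complementPerm,
        LinearIsometryEquiv.inner_map_map]) (ket (glueEquiv S (a, e))) (ket (glueEquiv S (b, e)))
    simp only [LinearIsometryEquiv.coe_toLinearIsometry, relabel_ket, complementPerm_glueEquiv,
      Equiv.swap_apply_left, inner_ket_left] at key
    exact key.symm

end Reduced

/-! ### Matrix units of a cell -/

section MatUnit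

variable {n : ℕ} {A : Type u} [Zero A]

theorem exists_glueEmb_eq (x : Grid n) (c : Config n A) :
    ∃ u e, glueEmb {x} (fun _ => u) e = c := by
  obtain ⟨⟨a, e⟩, rfl⟩ := (glueEquiv {x}).surjective c
  refine ⟨a ⟨x, Finset.mem_singleton_self x⟩, e, congrArg (glueEquiv {x}) ?_⟩
  refine Prod.ext (funext fun y => congrArg a ?_) rfl
  exact Subtype.ext (Finset.mem_singleton.1 y.2).symm

theorem glueEmb_singleton_apply (x : Grid n) (u : A) (e) : glueEmb {x} (fun _ => u) e x = u :=
  glue_of_mem _ _ (Finset.mem_singleton_self x)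

theorem update_glueEmb_singleton (x : Grid n) (u v : A) (e) :
    (glueEmb {x} (fun _ => u) e).update x v = glueEmb {x} (fun _ => v) e := by
  classical
  ext y
  rw [Finsupp.update_apply]
  split_ifs with h
  · rw [h, glueEmb_singleton_apply]
  · have hy : y ∉ ({x} : Finset (Grid n)) := by simpa using h
    rw [glueEmb_apply, glueEmb_apply, glue_of_notMem _ _ hy, glue_of_notMem _ _ hy]

theorem adjoint_matUnit (x : Grid n) (u v : A) : (matUnit x u v).adjoint = matUnit x v u := by
  refine (ContinuousLinearMap.eq_adjoint_iff _ _).2 (fun ψ φ => ?_) |>.symm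
  rw [← inner_conj_symm, inner_matUnit, inner_conj_symm, inner_matUnit]

theorem translation_ket (v : Grid n) (c : Config n A) :
    translation v (ket c) = ket (shift v c) := relabel_ket _ _

theorem shift_zero_config (v : Grid n) : shift v (0 : Config n A) = 0 := rfl

theorem shift_update (v x : Grid n) (c : Config n A) (u : A) :
    shift v (c.update (x + v) u) = (shift v c).update x u := by
  classical
  ext y
  simp only [shift_apply, Finsupp.update_apply, add_left_inj]

theorem matUnit_ket [DecidableEq A] (x : Grid n) (u v : A) (c : Config n A) :
    matUnit x u v (ket c) = if c x = v then ket (c.update x u) else 0 := by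
  obtain ⟨w, e, rfl⟩ := exists_glueEmb_eq x c
  rw [matUnit, ContinuousLinearMap.comp_apply, partialBra, glueEmb_singleton_apply,
    update_glueEmb_singleton]
  split_ifs with h
  · rw [h, restrict_ket, embed_ket]
  · rw [restrict_ket_of_notMem, map_zero]
    rintro ⟨f, hf⟩
    rw [← glueEmb_singleton_apply x w e, ← hf, glueEmb_singleton_apply] at h
    exact h rfl

theorem matUnit_comp_matUnit [DecidableEq A] (x : Grid n) (u v u' v' : A) :
    matUnit x u v ∘L matUnit x u' v' = if u' = v then matUnit x u v' else 0 := by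
  refine clm_ext_ket fun c => ?_
  rw [ContinuousLinearMap.comp_apply, matUnit_ket]
  split_ifs with h h' h'
  · rw [matUnit_ket, matUnit_ket, if_pos h, if_pos (by simp [h']), Finsupp.update_idem]
  · rw [matUnit_ket, if_neg (by simpa using h')]
    rfl
  · rw [map_zero, matUnit_ket, if_neg h]
  · exact map_zero _

theorem sum_matUnit [Fintype A] (x : Grid n) :
    ∑ u : A, matUnit x u u = ContinuousLinearMap.id ℂ (StateSpace n A) := by
  classical
  refine clm_ext_ket fun c => ?_
  rw [sum_apply]
  simp [matUnit_ket]

theorem matUnit_translation (x v : Grid n) (u u' : A) (φ : StateSpace n A) :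
    matUnit x u u' (translation v φ) = translation v (matUnit (x + v) u u' φ) := by
  classical
  have h : matUnit x u u' ∘L (translation (A := A) v : StateSpace n A →L[ℂ] StateSpace n A) =
      (translation (A := A) v : StateSpace n A →L[ℂ] StateSpace n A) ∘L
        matUnit (x + v) u u' := by
    refine clm_ext_ket fun c => ?_
    change matUnit x u u' (translation v (ket c)) = translation v (matUnit (x + v) u u' (ket c))
    rw [translation_ket, matUnit_ket, matUnit_ket, shift_apply]
    split_ifs
    · rw [translation_ket, shift_update]
    · rw [map_zero]
  exact DFunLike.congr_fun h φ

end MatUnit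

/-! ### Operators acting on a single supercell -/

section UpdateBlock

variable {n : ℕ} {A : Type u} [Zero A] (L : ℕ) [NeZero L]

theorem group_apply (c : Config n A) (x : Grid n) (p : Fin n → Fin L) :
    group L c x p = c (cellAt L x p) := rfl

/-- The configuration `c` with its supercell `x` replaced by `a`. -/
def updateBlock (c : Config n A) (x : Grid n) (a : Block n L A) : Config n A :=
  (group L).symm ((group L c).update x a)

theorem updateBlock_apply (c : Config n A) (x : Grid n) (a : Block n L A) (y : Grid n) :
    updateBlock L c x a y = if supercellOf L y = x then a (offsetOf L y) else c y := by
  classical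
  change (group L c).update x a (supercellOf L y) (offsetOf L y) = _
  rw [Finsupp.update_apply]
  split_ifs
  · rfl
  · rw [group_apply, cellAt_of]

theorem group_updateBlock (c : Config n A) (x : Grid n) (a : Block n L A) :
    group L (updateBlock L c x a) x = a := by
  classical
  rw [updateBlock, Equiv.apply_symm_apply, Finsupp.update_apply, if_pos rfl]

theorem updateBlock_injective (c : Config n A) (x : Grid n) :
    Function.Injective (updateBlock L c x) := fun a b h => by
  rw [← group_updateBlock L c x a, h, group_updateBlock]

theorem updateBlock_group (c : Config n A) (x : Grid n) :
    updateBlock L c x (group L c x) = c := by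
  rw [updateBlock, Finsupp.update_self, Equiv.symm_apply_apply]

theorem updateBlock_updateBlock (c : Config n A) (x : Grid n) (a b : Block n L A) :
    updateBlock L (updateBlock L c x a) x b = updateBlock L c x b := by
  rw [updateBlock, updateBlock, Equiv.apply_symm_apply, Finsupp.update_idem, updateBlock]

theorem eq_updateBlock_of_eq_off {c d : Config n A} {x : Grid n}
    (h : ∀ y, supercellOf L y ≠ x → d y = c y) : d = updateBlock L c x (group L d x) := by
  ext y
  rw [updateBlock_apply]
  split_ifs with hy
  · rw [← hy, group_apply, cellAt_of]
  · exact h y hy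

theorem group_shift (v : Grid n) (c : Config n A) :
    group L (shift (fun i => (L : ℤ) * v i) c) = shift v (group L c) := by
  ext x p
  rw [group_apply, shift_apply, shift_apply, group_apply]
  refine congrArg c (funext fun i => ?_)
  simp only [cellAt, Pi.add_apply]
  ring

theorem shift_updateBlock (x v : Grid n) (c : Config n A) (a : Block n L A) :
    shift (fun i => (L : ℤ) * v i) (updateBlock L c (x + v) a) =
      updateBlock L (shift (fun i => (L : ℤ) * v i) c) x a := by
  classical
  rw [updateBlock, updateBlock, Equiv.eq_symm_apply, group_shift, Equiv.apply_symm_apply,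
    group_shift, shift_update]

/-- The matrix of the operator `T` over the supercell `x`, the other supercells being empty. -/
def blockMat (x : Grid n) (T : Op n A) : Matrix (Block n L A) (Block n L A) ℂ :=
  .of fun a b => T (ket (updateBlock L 0 x b)) (updateBlock L 0 x a)

theorem blockMat_adjoint (x : Grid n) (T : Op n A) :
    blockMat L x T.adjoint = (blockMat L x T)ᴴ := by
  ext a b
  simp only [blockMat, Matrix.of_apply, Matrix.conjTranspose_apply, ← inner_ket_left,
    ContinuousLinearMap.adjoint_inner_right]
  exact (inner_conj_symm _ _).symm

theorem blockMat_id [DecidableEq A] (x : Grid n) :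
    blockMat L x (ContinuousLinearMap.id ℂ (StateSpace n A)) = 1 := by
  classical
  ext a b
  simp only [blockMat, Matrix.of_apply, ContinuousLinearMap.id_apply, ket_apply,
    (updateBlock_injective L _ x).eq_iff, Matrix.one_apply]

variable {L} [Fintype A]

theorem IsLocalOn.apply_ket {x : Grid n} {T : Op n A}
    (hT : IsLocalOn {y | supercellOf L y = x} T) (c : Config n A) :
    T (ket c) = ∑ a, blockMat L x T a (group L c x) • ket (updateBlock L c x a) := by
  classical
  ext d
  rw [lp.coeFn_sum, Finset.sum_apply]
  simp only [lp.coeFn_smul, Pi.smul_apply, ket_apply, smul_eq_mul, mul_ite, mul_one, mul_zero]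
  by_cases hd : ∀ y, supercellOf L y ≠ x → d y = c y
  · rw [eq_updateBlock_of_eq_off L hd]
    simp only [(updateBlock_injective L _ x).eq_iff, Finset.sum_ite_eq, Finset.mem_univ, if_true,
      blockMat, Matrix.of_apply]
    refine hT.congr _ _ _ _ (fun y (hy : supercellOf L y ≠ x) => ?_)
      (fun y (hy : supercellOf L y ≠ x) => ?_) (fun y (hy : supercellOf L y = x) => ?_)
      fun y (hy : supercellOf L y = x) => ?_
    · rw [updateBlock_apply, if_neg hy]
    · rw [updateBlock_apply, updateBlock_apply, if_neg hy, if_neg hy]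
    · rw [updateBlock_apply, updateBlock_apply, if_pos hy, if_pos hy]
    · rw [updateBlock_apply, if_pos hy, group_apply, ← hy, cellAt_of]
  · push Not at hd
    obtain ⟨y, hy, hne⟩ := hd
    rw [hT.eq_zero _ _ y hy hne, Finset.sum_eq_zero]
    rintro a -
    refine if_neg ?_
    rintro rfl
    exact hne (by rw [updateBlock_apply, if_neg hy])

theorem IsLocalOn.blockMat_comp {x : Grid n} {T : Op n A}
    (hT : IsLocalOn {y | supercellOf L y = x} T) (S : Op n A) :
    blockMat L x (S ∘L T) = blockMat L x S * blockMat L x T := by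
  ext a b
  rw [blockMat, Matrix.of_apply, ContinuousLinearMap.comp_apply, hT.apply_ket, map_sum,
    lp.coeFn_sum, Finset.sum_apply, Matrix.mul_apply]
  refine Finset.sum_congr rfl fun a' _ => ?_
  rw [map_smul, group_updateBlock, updateBlock_updateBlock, lp.coeFn_smul, Pi.smul_apply,
    smul_eq_mul, mul_comm]
  rfl

end UpdateBlock

/-! ### Quantum cellular automata of bounded radius -/

theorem heisenberg_shift {n : ℕ} {A : Type u} [Zero A] {G : Op n A} {v : Grid n} {S T : Op n A}
    (hG : ∀ φ, G (translation v φ) = translation v (G φ))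
    (hST : ∀ φ, S (translation v φ) = translation v (T φ)) (c d : Config n A) :
    heisenberg G S (ket (shift v c)) (shift v d) = heisenberg G T (ket c) d := by
  classical
  rw [← inner_ket_left, ← inner_ket_left, ← translation_ket, ← translation_ket, inner_heisenberg,
    inner_heisenberg, hG, hG, hST, LinearIsometryEquiv.inner_map_map]

/-- A quiescent QCA of radius at most `r`, with causality stated in the Heisenberg picture. -/
structure HasRadius {n : ℕ} {A : Type u} [Zero A] (r : ℕ) (G : Op n A) : Prop where
  unitary : G ∈ unitary (Op n A)
  translation_comm : ∀ (v : Grid n) (ψ : StateSpace n A), G (translation v ψ) = translation v (G ψ)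
  quiescent : G (ket 0) = ket 0
  isLocalOn : ∀ (x : Grid n) (u v : A),
    IsLocalOn {y | ∀ i, |y i - x i| ≤ r} (heisenberg G (matUnit x u v))

section Local

variable {n r : ℕ} {A : Type u} [Zero A] {G : Op n A}

variable (n r) in
/-- The position of the central cell of a supercell of side `2 r + 1`. -/
def center : Fin n → Fin (2 * r + 1) := fun _ => ⟨r, by omega⟩

/-- The central cell of the supercell `x`. -/
def centerOf (r : ℕ) (x : Grid n) : Grid n := cellAt (2 * r + 1) x (center n r)

theorem supercellOf_eq_of_near {x y : Grid n} (h : ∀ i, |y i - centerOf r x i| ≤ r) :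
    supercellOf (2 * r + 1) y = x := by
  funext i
  have h1 := abs_le.1 (h i)
  simp only [centerOf, cellAt, center] at h1
  simp only [supercellOf]
  push_cast at h1 ⊢
  rw [Int.ediv_eq_iff_of_pos (by positivity)]
  constructor <;> nlinarith

theorem centerOf_zero_add (x : Grid n) :
    (centerOf r 0 + fun i => ((2 * r + 1 : ℕ) : ℤ) * x i) = centerOf r x := by
  funext i
  simp [centerOf, cellAt, add_comm]

/-- The matrix, over the supercell of side `2 r + 1` around a cell, of the Heisenberg evolution
under `G` of the matrix unit `|u⟩⟨v|` of that cell. -/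
def localMat (r : ℕ) (G : Op n A) (u v : A) :
    Matrix (Block n (2 * r + 1) A) (Block n (2 * r + 1) A) ℂ :=
  blockMat (2 * r + 1) 0 (heisenberg G (matUnit (centerOf r 0) u v))

namespace HasRadius

theorem isLocalOn_supercell (hG : HasRadius r G) (x : Grid n) (u v : A) :
    IsLocalOn {y | supercellOf (2 * r + 1) y = x} (heisenberg G (matUnit (centerOf r x) u v)) :=
  (hG.isLocalOn _ u v).mono fun _ hy => supercellOf_eq_of_near hy

theorem conjTranspose_localMat (u v : A) : (localMat r G u v)ᴴ = localMat r G v u := by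
  rw [localMat, ← blockMat_adjoint, adjoint_heisenberg, adjoint_matUnit, localMat]

theorem blockMat_heisenberg_matUnit (hG : HasRadius r G) (x : Grid n) (u v : A) :
    blockMat (2 * r + 1) x (heisenberg G (matUnit (centerOf r x) u v)) = localMat r G u v := by
  have hshift (a : Block n (2 * r + 1) A) :
      shift (fun i => ((2 * r + 1 : ℕ) : ℤ) * x i) (updateBlock (2 * r + 1) 0 x a) =
        updateBlock (2 * r + 1) 0 0 a := by
    have h := shift_updateBlock (2 * r + 1) 0 x (0 : Config n A) a
    rw [zero_add, shift_zero_config] at h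
    exact h
  ext a b
  have h := heisenberg_shift (S := matUnit (centerOf r 0) u v)
    (T := matUnit (centerOf r 0 + fun i => ((2 * r + 1 : ℕ) : ℤ) * x i) u v)
    (hG.translation_comm fun i => ((2 * r + 1 : ℕ) : ℤ) * x i)
    (matUnit_translation _ _ u v)
    (updateBlock (2 * r + 1) 0 x b) (updateBlock (2 * r + 1) 0 x a)
  rw [hshift, hshift, centerOf_zero_add] at h
  rw [localMat, blockMat, blockMat, Matrix.of_apply, Matrix.of_apply, h]

theorem localMat_mul_localMat [Fintype A] [DecidableEq A] (hG : HasRadius r G) (u v u' v' : A) :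
    localMat r G u v * localMat r G u' v' = if u' = v then localMat r G u v' else 0 := by
  rw [localMat, localMat, ← (hG.isLocalOn_supercell 0 u' v').blockMat_comp,
    ← heisenberg_comp hG.unitary, matUnit_comp_matUnit]
  split_ifs
  · rfl
  · ext a b
    simp [blockMat, heisenberg]

theorem sum_localMat [Fintype A] [DecidableEq A] (hG : HasRadius r G) :
    ∑ v, localMat r G v v = 1 := by
  rw [← blockMat_id (2 * r + 1) (0 : Grid n), ← heisenberg_id hG.unitary,
    ← sum_matUnit (centerOf r 0)]
  ext a b
  simp only [localMat, blockMat, Matrix.sum_apply, Matrix.of_apply, heisenberg,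
    ContinuousLinearMap.comp_apply, sum_apply, map_sum, lp.coeFn_sum, Finset.sum_apply]

theorem localMat_zero [DecidableEq A] (hG : HasRadius r G) (v : A) (a : Block n (2 * r + 1) A) :
    localMat r G 0 v a 0 = if v = 0 ∧ a = 0 then 1 else 0 := by
  classical
  have h0 : updateBlock (2 * r + 1) (0 : Config n A) 0 0 = 0 :=
    updateBlock_group (2 * r + 1) (0 : Config n A) 0
  have hket : G.adjoint (ket 0) = ket 0 := by
    have h := DFunLike.congr_fun (adjoint_comp_of_mem_unitary hG.unitary) (ket (0 : Config n A))
    rwa [ContinuousLinearMap.comp_apply, hG.quiescent] at h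
  change G.adjoint (matUnit (centerOf r 0) 0 v (G (ket (updateBlock (2 * r + 1) 0 0 0))))
    (updateBlock (2 * r + 1) 0 0 a) = _
  rw [h0, hG.quiescent, matUnit_ket, Finsupp.coe_zero, Pi.zero_apply]
  by_cases hv : v = 0
  · have hupd : (0 : Config n A).update (centerOf r 0) 0 = 0 := Finsupp.update_self _ _
    rw [if_pos hv.symm, hupd, hket, ket_apply]
    have hinj : updateBlock (2 * r + 1) (0 : Config n A) 0 a = 0 ↔ a = 0 :=
      ⟨fun h => updateBlock_injective _ _ _ (h.trans h0.symm), fun h => h ▸ h0⟩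
    simp only [hv, true_and, hinj]
  · rw [if_neg (Ne.symm hv), map_zero, if_neg fun h => hv h.1]
    rfl

theorem matUnit_map_ket [Fintype A] (hG : HasRadius r G) (x : Grid n) (u v : A) (c : Config n A) :
    matUnit (centerOf r x) u v (G (ket c)) =
      ∑ a, localMat r G u v a (group (2 * r + 1) c x) •
        G (ket (updateBlock (2 * r + 1) c x a)) := by
  have h := DFunLike.congr_fun (comp_heisenberg hG.unitary (matUnit (centerOf r x) u v)) (ket c)
  rw [ContinuousLinearMap.comp_apply, ContinuousLinearMap.comp_apply,
    (hG.isLocalOn_supercell x u v).apply_ket, map_sum] at h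
  simpa only [map_smul, hG.blockMat_heisenberg_matUnit] using h.symm

end HasRadius

end Local

/-! ### The gate of a cell -/

section OnFactor

open scoped Kronecker

variable {P X Y : Type*} [Fintype P] [Zero P] [DecidableEq P] [Fintype X] [Zero X] [DecidableEq X]
  [Fintype Y] [Zero Y] [DecidableEq Y]

/-- The local isometry `V ⊗ 1` of a space factorised as `ℂ^P ≃ ℂ^X ⊗ ℂ^Y`. -/
def LocalIsometry.onFactor (e : P ≃ X × Y) (h0 : e 0 = 0) (V : LocalIsometry X X) :
    LocalIsometry P P where
  mat := (V.mat ⊗ₖ (1 : Matrix Y Y ℂ)).submatrix e e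
  isometry := by
    rw [Matrix.conjTranspose_submatrix, Matrix.submatrix_mul_equiv, Matrix.conjTranspose_kronecker,
      ← Matrix.mul_kronecker_mul, V.isometry, Matrix.conjTranspose_one, Matrix.one_mul,
      Matrix.one_kronecker_one, Matrix.submatrix_one_equiv]
  quiescent := by
    ext p
    rw [Matrix.mulVec_single_one, Matrix.col_apply, Matrix.submatrix_apply, h0,
      Matrix.kronecker_apply, Prod.fst_zero, Prod.snd_zero, V.mat_zero, Matrix.one_apply,
      ite_zero_mul_ite_zero, one_mul, Pi.single_apply]
    refine if_congr ?_ rfl rfl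
    rw [← e.injective.eq_iff, h0, Prod.ext_iff]
    rfl

theorem LocalIsometry.sum_onFactor_mat_smul {M : Type*} [AddCommGroup M] [Module ℂ M]
    (e : P ≃ X × Y) (h0 : e 0 = 0) (V : LocalIsometry X X) (q : P) (f : P → M) :
    ∑ p, (V.onFactor e h0).mat p q • f p =
      ∑ x, V.mat x (e q).1 • f (e.symm (x, (e q).2)) := by
  rw [← e.symm.sum_comp, Fintype.sum_prod_type]
  simp [onFactor, Matrix.one_apply]

end OnFactor

section Gate

variable {n r : ℕ} {A : Type u}

variable (n r A) in
/-- A two-layered supercell, split into its first layer together with the central cell of its second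
layer, and the other cells of its second layer. -/
def centerEquiv : Block n (2 * r + 1) (A × A) ≃
    (Block n (2 * r + 1) A × A) × ({p // p ≠ center n r} → A) :=
  ((Equiv.arrowProdEquivProdArrow _ _ _).trans
    ((Equiv.refl _).prodCongr (Equiv.funSplitAt (center n r) A))).trans
      (Equiv.prodAssoc _ _ _).symm

theorem centerEquiv_symm_apply (a : Block n (2 * r + 1) A) (v : A)
    (o : {p // p ≠ center n r} → A) (p : Fin n → Fin (2 * r + 1)) :
    (centerEquiv n r A).symm ((a, v), o) p =
      (a p, if h : p = center n r then v else o ⟨p, h⟩) := by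
  simp [centerEquiv, Equiv.arrowProdEquivProdArrow, Equiv.funSplitAt, Equiv.piSplitAt]

theorem centerEquiv_zero [Zero A] : centerEquiv n r A 0 = 0 := rfl

namespace HasRadius

variable [Fintype A] [Zero A] [DecidableEq A] {G : Op n A}

/-- Swapping the two layers of a single cell, conjugated by `G` acting on the first layer: an
isometry of the first layer of the supercell around the cell and of the second layer of the cell. -/
def conjSwap (hG : HasRadius r G) :
    LocalIsometry (Block n (2 * r + 1) A × A) (Block n (2 * r + 1) A × A) where
  mat := .of fun p q => localMat r G q.2 p.2 p.1 q.1
  isometry := by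
    ext ⟨b, u⟩ ⟨b', u'⟩
    have h : ∑ v, localMat r G v u * localMat r G u' v = if u' = u then 1 else 0 := by
      simp only [hG.localMat_mul_localMat]
      split_ifs
      · exact hG.sum_localMat
      · simp
    simp only [Matrix.mul_apply, Fintype.sum_prod_type, Matrix.conjTranspose_apply, Matrix.of_apply]
    rw [Finset.sum_comm]
    have := congrFun₂ h b b'
    simp only [Matrix.sum_apply, Matrix.mul_apply, ← conjTranspose_localMat u] at this
    simp only [Matrix.conjTranspose_apply] at this
    rw [this]
    split_ifs with h
    · simp [h, Matrix.one_apply]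
    · simp [Ne.symm h]
  quiescent := by
    ext ⟨a, v⟩
    simp [hG.localMat_zero, Pi.single_apply, and_comm]

/-- The gate of the supercell around a cell that applies `HasRadius.conjSwap`. -/
def gate (hG : HasRadius r G) :
    LocalIsometry (Block n (2 * r + 1) (A × A)) (Block n (2 * r + 1) (A × A)) :=
  hG.conjSwap.onFactor (centerEquiv n r A) centerEquiv_zero

end HasRadius

end Gate

/-! ### Homogeneous tensor products acting on finitely many cells -/

section TensorOn

namespace LocalIsometry

variable {B : Type u} [Fintype B] [Zero B] [DecidableEq B] {n : ℕ}

/-- The vector obtained from `|c⟩` by applying `V` to each cell of `T`. -/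
def tensorOn (V : LocalIsometry B B) (T : Finset (Grid n)) (c : Config n B) : StateSpace n B :=
  ∑ a : T → B, (∏ x, V.mat (a x) (c x)) • ket (glue T a c)

theorem tensorOn_empty (V : LocalIsometry B B) (c : Config n B) : V.tensorOn ∅ c = ket c := by
  have h (a) : glue ∅ a c = c := by
    ext x
    exact glue_of_notMem _ _ (Finset.notMem_empty x)
  simp [tensorOn, h]

theorem tensorOn_insert (V : LocalIsometry B B) {T : Finset (Grid n)} {x : Grid n} (hx : x ∉ T)
    (c : Config n B) : V.tensorOn (insert x T) c =
      ∑ b, V.mat b (c x) • V.tensorOn T (c.update x b) := by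
  classical
  simp only [tensorOn, Finset.smul_sum, smul_smul]
  let e := Finset.subtypeInsertEquivOption hx
  rw [← (e.symm.arrowCongr (Equiv.refl B)).sum_comp,
    ← Equiv.piOptionEquivProd.symm.sum_comp, Fintype.sum_prod_type]
  refine Finset.sum_congr rfl fun b _ => Finset.sum_congr rfl fun a _ => ?_
  set a' := e.symm.arrowCongr (Equiv.refl B) (Equiv.piOptionEquivProd.symm (b, a))
  have hnone : a' ⟨x, Finset.mem_insert_self x T⟩ = b :=
    congrArg (Equiv.piOptionEquivProd.symm (b, a)) (e.apply_symm_apply none)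
  have hsome (y : T) : a' ⟨y, Finset.mem_insert_of_mem y.2⟩ = a y :=
    congrArg (Equiv.piOptionEquivProd.symm (b, a)) (e.apply_symm_apply (some y))
  congr 1
  · rw [← e.symm.prod_comp, Fintype.prod_option]
    refine congrArg₂ _ (congrArg (V.mat · _) hnone) (Finset.prod_congr rfl fun y _ => ?_)
    rw [Finsupp.update_apply, if_neg (ne_of_mem_of_not_mem y.2 hx), ← hsome]
    rfl
  · congr 1
    ext y
    by_cases hy : y ∈ T
    · rw [glue_of_mem _ _ hy, glue_of_mem _ _ (Finset.mem_insert_of_mem hy), ← hsome]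
    · rw [glue_of_notMem _ _ hy, Finsupp.update_apply]
      split_ifs with hyx
      · subst hyx
        rw [glue_of_mem _ _ (Finset.mem_insert_self y T), hnone]
      · rw [glue_of_notMem _ _ (by simp [hy, hyx])]

theorem tensor_ket_eq_tensorOn (V : LocalIsometry B B) {T : Finset (Grid n)} {c : Config n B}
    (hc : c.support ⊆ T) : V.tensor n (ket c) = V.tensorOn T c := by
  rw [V.tensor_ket_eq_sum T c hc, tensorOn]
  refine Finset.sum_congr rfl fun a _ => ?_
  congr 2
  ext x
  by_cases hx : x ∈ T
  · rw [glue_of_mem _ _ hx, glue_of_mem _ _ hx]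
  · rw [glue_of_notMem _ _ hx, glue_of_notMem _ _ hx, Finsupp.notMem_support_iff.1 (mt (@hc x) hx)]
    rfl

end LocalIsometry

end TensorOn

/-! ### Two-layered configurations -/

section Layers

variable {n : ℕ} {A : Type u} [Zero A]

/-- The two-layered configuration of first layer `b` and second layer `β`. -/
def layers (b β : Config n A) : Config n (A × A) := Finsupp.zipWith Prod.mk rfl b β

@[simp]
theorem layers_apply (b β : Config n A) (x : Grid n) : layers b β x = (b x, β x) := rfl

/-- The first layer of a two-layered configuration. -/
def firstLayer (q : Config n (A × A)) : Config n A := q.mapRange Prod.fst rfl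

/-- The second layer of a two-layered configuration. -/
def secondLayer (q : Config n (A × A)) : Config n A := q.mapRange Prod.snd rfl

theorem firstLayer_layers (b β : Config n A) : firstLayer (layers b β) = b := by
  ext x
  rfl

theorem secondLayer_layers (b β : Config n A) : secondLayer (layers b β) = β := by
  ext x
  rfl

theorem layers_firstLayer_secondLayer (q : Config n (A × A)) :
    layers (firstLayer q) (secondLayer q) = q := by
  ext x <;> rfl

theorem exists_layers_eq (q : Config n (A × A)) : ∃ b β, layers b β = q :=
  ⟨_, _, layers_firstLayer_secondLayer q⟩

theorem layers_inj {b b' β β' : Config n A} : layers b β = layers b' β' ↔ b = b' ∧ β = β' :=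
  ⟨fun h => ⟨by rw [← firstLayer_layers b β, h, firstLayer_layers],
    by rw [← secondLayer_layers b β, h, secondLayer_layers]⟩, fun h => by rw [h.1, h.2]⟩

/-- The injection `b ↦ layers b β`. -/
def withSecond (β : Config n A) : Config n A ↪ Config n (A × A) :=
  ⟨fun b => layers b β, fun _ _ h => (layers_inj.1 h).1⟩

@[simp]
theorem withSecond_apply (b β : Config n A) : withSecond β b = layers b β := rfl

/-- The injection `β ↦ layers b β`. -/
def withFirst (b : Config n A) : Config n A ↪ Config n (A × A) :=
  ⟨fun β => layers b β, fun _ _ h => (layers_inj.1 h).2⟩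

@[simp]
theorem withFirst_apply (b β : Config n A) : withFirst b β = layers b β := rfl

theorem shift_layers (v : Grid n) (b β : Config n A) :
    shift v (layers b β) = layers (shift v b) (shift v β) := by
  ext x <;> rfl

theorem translation_embed_withSecond (v : Grid n) (β : Config n A) (φ : StateSpace n A) :
    translation v (embed (withSecond β) φ) = embed (withSecond (shift v β)) (translation v φ) := by
  have h : (translation (A := A × A) v : StateSpace n (A × A) →L[ℂ] StateSpace n (A × A)) ∘L
      embed (withSecond β) = embed (withSecond (shift v β)) ∘L
        (translation (A := A) v : StateSpace n A →L[ℂ] StateSpace n A) := by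
    refine clm_ext_ket fun b => ?_
    change translation v (embed (withSecond β) (ket b)) =
      embed (withSecond (shift v β)) (translation v (ket b))
    rw [embed_ket, translation_ket, translation_ket, embed_ket, withSecond_apply, shift_layers,
      withSecond_apply]
  exact DFunLike.congr_fun h φ

open Classical in
/-- The exchange of the two layers of the cells of `S`. -/
def exchange (S : Set (Grid n)) : Equiv.Perm (Config n (A × A)) :=
  Function.Involutive.toPerm
    (fun q => Finsupp.onFinset q.support (fun x => if x ∈ S then (q x).swap else q x) fun x hx =>
      Finsupp.mem_support_iff.2 fun h => hx (by rw [h, Prod.swap_zero, ite_self]))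
    fun q => by
      ext1 x
      simp only [Finsupp.onFinset_apply]
      split_ifs
      · exact Prod.swap_swap _
      · rfl

open Classical in
theorem exchange_apply (S : Set (Grid n)) (q : Config n (A × A)) (x : Grid n) :
    exchange S q x = if x ∈ S then (q x).swap else q x := rfl

theorem exchange_exchange {S T : Set (Grid n)} (h : Disjoint S T) (q : Config n (A × A)) :
    exchange S (exchange T q) = exchange (S ∪ T) q := by
  classical
  ext1 x
  rw [exchange_apply, exchange_apply, exchange_apply]
  by_cases hS : x ∈ S
  · rw [if_pos hS, if_neg (Set.disjoint_left.1 h hS), if_pos (Set.mem_union_left T hS)]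
  · rw [if_neg hS, Set.mem_union, or_iff_right hS]

theorem relabel_exchange_exchange {S T : Set (Grid n)} (h : Disjoint S T)
    (φ : StateSpace n (A × A)) :
    relabel (exchange S) (relabel (exchange T) φ) = relabel (exchange (S ∪ T)) φ := by
  ext q
  change φ (exchange T (exchange S q)) = φ (exchange (S ∪ T) q)
  rw [exchange_exchange h.symm, Set.union_comm]

theorem relabel_exchange_self (S : Set (Grid n)) (φ : StateSpace n (A × A)) :
    relabel (exchange S) (relabel (exchange S) φ) = φ :=
  (relabel (exchange S)).apply_symm_apply φ

theorem exchange_empty (q : Config n (A × A)) : exchange ∅ q = q := by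
  ext1 x
  exact if_neg (Set.notMem_empty x)

theorem exchange_congr {S T : Set (Grid n)} {q : Config n (A × A)}
    (h : ∀ x ∈ q.support, x ∈ S ↔ x ∈ T) : exchange S q = exchange T q := by
  classical
  ext1 x
  rw [exchange_apply, exchange_apply]
  by_cases hx : x ∈ q.support
  · rw [if_congr (h x hx) rfl rfl]
  · rw [Finsupp.notMem_support_iff.1 hx, Prod.swap_zero, ite_self, ite_self]

theorem exchange_univ_layers (b β : Config n A) : exchange Set.univ (layers b β) = layers β b := by
  ext1 x
  exact if_pos (Set.mem_univ x)

theorem exchange_singleton_layers (b β : Config n A) (y : Grid n) :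
    exchange {y} (layers b β) = layers (b.update y (β y)) (β.update y (b y)) := by
  classical
  ext1 x
  rw [exchange_apply, layers_apply, layers_apply, Finsupp.update_apply, Finsupp.update_apply]
  by_cases h : x = y
  · simp [h]
  · simp [h]

theorem exchange_shift (v : Grid n) (S : Set (Grid n)) (q : Config n (A × A)) :
    exchange S (shift v q) = shift v (exchange {x | x - v ∈ S} q) := by
  classical
  ext1 x
  rw [shift_apply, exchange_apply, exchange_apply, shift_apply, Set.mem_ofPred_eq,
    add_sub_cancel_right]

theorem relabel_exchange_translation (v : Grid n) (S : Set (Grid n)) (φ : StateSpace n (A × A)) :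
    relabel (exchange S) (translation v φ) =
      translation v (relabel (exchange {x | x - v ∈ S}) φ) := by
  ext q
  have h : (shift v).symm (exchange S q) = exchange {x | x - v ∈ S} ((shift v).symm q) := by
    rw [Equiv.symm_apply_eq, ← exchange_shift, Equiv.apply_symm_apply]
  exact congrArg φ h

theorem relabel_exchange_univ_embed (β : Config n A) (φ : StateSpace n A) :
    relabel (exchange Set.univ) (embed (withSecond β) φ) = embed (withFirst β) φ := by
  have h : (relabel (exchange (n := n) (A := A) Set.univ) :
        StateSpace n (A × A) →L[ℂ] StateSpace n (A × A)) ∘L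
      embed (withSecond β) = embed (withFirst β) := by
    refine clm_ext_ket fun b => ?_
    change relabel (exchange Set.univ) (embed (withSecond β) (ket b)) = _
    rw [embed_ket, relabel_ket, embed_ket, withSecond_apply, exchange_univ_layers, withFirst_apply]
  exact DFunLike.congr_fun h φ

theorem relabel_exchange_singleton_embed [Fintype A] (β : Config n A) (y : Grid n)
    (φ : StateSpace n A) :
    relabel (exchange {y}) (embed (withSecond β) φ) =
      ∑ v, embed (withSecond (β.update y v)) (matUnit y (β y) v φ) := by
  classical
  have h : (relabel (exchange (A := A) {y}) : StateSpace n (A × A) →L[ℂ] StateSpace n (A × A)) ∘L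
      embed (withSecond β) = ∑ v, embed (withSecond (β.update y v)) ∘L matUnit y (β y) v := by
    refine clm_ext_ket fun b => ?_
    rw [sum_apply]
    change relabel (exchange {y}) (embed (withSecond β) (ket b)) =
      ∑ v, embed (withSecond (β.update y v)) (matUnit y (β y) v (ket b))
    simp [matUnit_ket, relabel_ket, exchange_singleton_layers, apply_ite]
  exact (DFunLike.congr_fun h φ).trans (sum_apply _ _ _)

end Layers

section OnFirst

variable {n : ℕ} {A : Type u} [Zero A] {G : Op n A}

theorem inner_embed_embed_self {X Y : Type*} (f : X ↪ Y) (φ ψ : L2 X) :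
    inner ℂ (embed f φ) (embed f ψ) = inner ℂ φ ψ :=
  LinearIsometry.inner_map_map _ φ ψ

theorem inner_embed_embed_of_disjoint {X Y : Type*} {f g : X ↪ Y}
    (h : Disjoint (Set.range f) (Set.range g)) (φ ψ : L2 X) :
    inner ℂ (embed f φ) (embed g ψ) = 0 := by
  have h0 : restrict f (embed g ψ) = 0 := by
    ext x
    rw [restrict_apply, embed_apply_of_notMem _ _ (Set.disjoint_left.1 h ⟨x, rfl⟩)]
    rfl
  rw [← ContinuousLinearMap.adjoint_inner_right, ← restrict, h0, inner_zero_right]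

theorem orthonormal_embed_withSecond (hG : G ∈ unitary (Op n A)) :
    Orthonormal ℂ fun q : Config n (A × A) =>
      embed (withSecond (secondLayer q)) (G (ket (firstLayer q))) := by
  classical
  refine orthonormal_iff_ite.2 fun q q' => ?_
  obtain ⟨b, β, rfl⟩ := exists_layers_eq q
  obtain ⟨b', β', rfl⟩ := exists_layers_eq q'
  simp only [firstLayer_layers, secondLayer_layers, layers_inj]
  by_cases hβ : β = β'
  · rw [hβ, inner_embed_embed_self, ← ContinuousLinearMap.adjoint_inner_right,
      ← ContinuousLinearMap.comp_apply, adjoint_comp_of_mem_unitary hG,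
      ContinuousLinearMap.id_apply, orthonormal_iff_ite.1 orthonormal_ket]
    simp only [and_true]
  · rw [if_neg fun h => hβ h.2, inner_embed_embed_of_disjoint]
    refine Set.disjoint_left.2 ?_
    rintro _ ⟨c, rfl⟩ ⟨c', h⟩
    exact hβ (layers_inj.1 h).2.symm

/-- The unitary `G` acting on the first layer. -/
def onFirst (hG : G ∈ unitary (Op n A)) : StateSpace n (A × A) →ₗᵢ[ℂ] StateSpace n (A × A) :=
  ofOrthonormal (orthonormal_embed_withSecond hG)

theorem onFirst_ket (hG : G ∈ unitary (Op n A)) (b β : Config n A) :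
    onFirst hG (ket (layers b β)) = embed (withSecond β) (G (ket b)) := by
  rw [onFirst, ofOrthonormal_ket, firstLayer_layers, secondLayer_layers]

theorem onFirst_translation (hG : G ∈ unitary (Op n A)) {v : Grid n}
    (hv : ∀ ψ, G (translation v ψ) = translation v (G ψ)) (φ : StateSpace n (A × A)) :
    onFirst hG (translation v φ) = translation v (onFirst hG φ) := by
  have h : (onFirst hG).toContinuousLinearMap ∘L
      (translation (A := A × A) v : StateSpace n (A × A) →L[ℂ] StateSpace n (A × A)) =
      (translation (A := A × A) v : StateSpace n (A × A) →L[ℂ] StateSpace n (A × A)) ∘L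
        (onFirst hG).toContinuousLinearMap := by
    refine clm_ext_ket fun q => ?_
    obtain ⟨b, β, rfl⟩ := exists_layers_eq q
    change onFirst hG (translation v (ket _)) = translation v (onFirst hG (ket _))
    rw [translation_ket, shift_layers, onFirst_ket, onFirst_ket, ← translation_ket, hv,
      translation_embed_withSecond]
  exact DFunLike.congr_fun h φ

theorem onFirst_embed_withFirst (hG : G ∈ unitary (Op n A)) (h0 : G (ket 0) = ket 0)
    (φ : StateSpace n A) :
    onFirst hG (embed (withFirst 0) φ) = embed (withFirst 0) φ := by
  have h : (onFirst hG).toContinuousLinearMap ∘L embed (withFirst 0) = embed (withFirst 0) := by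
    refine clm_ext_ket fun β => ?_
    change onFirst hG (embed (withFirst 0) (ket β)) = embed (withFirst 0) (ket β)
    rw [embed_ket, withFirst_apply, onFirst_ket, h0, embed_ket, withSecond_apply]
  exact DFunLike.congr_fun h φ

end OnFirst

/-! ### The circuit of a QCA -/

section GateAction

variable {n r : ℕ} {A : Type u} [Zero A] {G : Op n A}

theorem updateBlock_layers_centerEquiv_symm (b β : Config n A) (x : Grid n)
    (a : Block n (2 * r + 1) A) (v : A) :
    updateBlock (2 * r + 1) (layers b β) x ((centerEquiv n r A).symm
      ((a, v), (centerEquiv n r A (group (2 * r + 1) (layers b β) x)).2)) =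
    layers (updateBlock (2 * r + 1) b x a) (β.update (centerOf r x) v) := by
  classical
  ext1 y
  rw [updateBlock_apply, layers_apply, layers_apply, updateBlock_apply, Finsupp.update_apply]
  have hy : y = centerOf r x ↔ supercellOf (2 * r + 1) y = x ∧
      offsetOf (2 * r + 1) y = center n r := by
    constructor
    · rintro rfl
      exact ⟨supercellOf_cellAt _ _ _, offsetOf_cellAt _ _ _⟩
    · rintro ⟨rfl, h⟩
      rw [centerOf, ← h, cellAt_of]
  by_cases hx : supercellOf (2 * r + 1) y = x
  · rw [if_pos hx, if_pos hx, centerEquiv_symm_apply, if_congr hy rfl rfl]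
    simp only [hx, true_and]
    split_ifs with h
    · rfl
    · refine congrArg (Prod.mk _) ?_
      rw [← hx]
      change (layers b β (cellAt _ _ (offsetOf _ y))).2 = β y
      rw [cellAt_of, layers_apply]
  · rw [if_neg hx, if_neg hx, if_neg fun h => hx (hy.1 h).1]

namespace HasRadius

variable [Fintype A] [DecidableEq A]

theorem sum_gate_mat_smul (hG : HasRadius r G) (x : Grid n) (q : Config n (A × A)) :
    ∑ w, hG.gate.mat w (group (2 * r + 1) q x) •
        onFirst hG.unitary (ket (updateBlock (2 * r + 1) q x w)) =
      relabel (exchange {centerOf r x}) (onFirst hG.unitary (ket q)) := by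
  obtain ⟨b, β, rfl⟩ := exists_layers_eq q
  rw [gate, LocalIsometry.sum_onFactor_mat_smul, Fintype.sum_prod_type, Finset.sum_comm,
    onFirst_ket, relabel_exchange_singleton_embed]
  refine Finset.sum_congr rfl fun v _ => ?_
  rw [hG.matUnit_map_ket, map_sum]
  refine Finset.sum_congr rfl fun a _ => ?_
  rw [updateBlock_layers_centerEquiv_symm, onFirst_ket, map_smul]
  rfl

theorem onFirst_tensorOn_gate (hG : HasRadius r G) (T : Finset (Grid n))
    (q : Config n (Block n (2 * r + 1) (A × A))) :
    onFirst hG.unitary (relabel (group (2 * r + 1)).symm (hG.gate.tensorOn T q)) =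
      relabel (exchange (centerOf r '' T))
        (onFirst hG.unitary (ket ((group (2 * r + 1)).symm q))) := by
  classical
  induction T using Finset.induction_on generalizing q with
  | empty =>
    rw [LocalIsometry.tensorOn_empty, relabel_ket, Finset.coe_empty, Set.image_empty]
    ext d
    exact congrArg _ (exchange_empty d).symm
  | insert x T hx ih =>
    have hdisj : Disjoint (centerOf r '' T) {centerOf r x} := by
      rw [Set.disjoint_singleton_right]
      rintro ⟨y, hy, h⟩
      rw [← supercellOf_cellAt (2 * r + 1) x (center n r), ← centerOf, ← h, centerOf,
        supercellOf_cellAt] at hx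
      exact hx hy
    rw [LocalIsometry.tensorOn_insert _ hx, map_sum, map_sum, Finset.coe_insert,
      Set.image_insert_eq, Set.insert_eq, Set.union_comm, ← relabel_exchange_exchange hdisj,
      ← hG.sum_gate_mat_smul, map_sum, Equiv.apply_symm_apply]
    refine Finset.sum_congr rfl fun w _ => ?_
    rw [map_smul, map_smul, ih, map_smul, updateBlock, Equiv.apply_symm_apply]

theorem onFirst_tensor_gate (hG : HasRadius r G) (q : Config n (A × A)) :
    onFirst hG.unitary (conjRelabel (group (2 * r + 1)).symm (hG.gate.tensor n) (ket q)) =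
      relabel (exchange (Set.range (centerOf r))) (onFirst hG.unitary (ket q)) := by
  classical
  ext d
  set T := (group (2 * r + 1) q).support ∪ (group (2 * r + 1) d).support
  rw [conjRelabel_ket, Equiv.symm_symm, hG.gate.tensor_ket_eq_tensorOn (T := T)
    Finset.subset_union_left, hG.onFirst_tensorOn_gate, Equiv.symm_apply_apply]
  refine congrArg (onFirst hG.unitary (ket q)) (exchange_congr fun y hy => ?_)
  refine ⟨fun h => Set.image_subset_range _ _ h, ?_⟩
  rintro ⟨x, rfl⟩
  refine ⟨x, Finset.mem_coe.2 (Finset.mem_union_right _ ?_), rfl⟩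
  refine Finsupp.mem_support_iff.2 fun h => ?_
  exact Finsupp.mem_support_iff.1 hy (congrFun h (center n r))

end HasRadius

end GateAction

section Centers

variable {n r : ℕ}

variable (r) in
/-- The centers of the windows of side `2 r + 1` at offset `c`. -/
def centers (c : Fin n → Fin (2 * r + 1)) : Set (Grid n) :=
  {y | offsetOf (2 * r + 1) y = center n r + c}

theorem offsetOf_add_toGrid {L : ℕ} [NeZero L] (y : Grid n) (c : Fin n → Fin L) :
    offsetOf L (y + toGrid c) = offsetOf L y + c := by
  have hL : (L : ℤ) ≠ 0 := by exact_mod_cast NeZero.ne L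
  funext i
  apply Fin.ext
  rw [Pi.add_apply, Fin.val_add]
  zify
  simp only [offsetOf, toGrid, Pi.add_apply, Int.toNat_of_nonneg (Int.emod_nonneg _ hL),
    Int.emod_add_emod]

theorem range_centerOf :
    Set.range (centerOf (n := n) r) = {y | offsetOf (2 * r + 1) y = center n r} := by
  ext y
  constructor
  · rintro ⟨x, rfl⟩
    exact offsetOf_cellAt _ _ _
  · intro h
    exact ⟨supercellOf (2 * r + 1) y, by rw [centerOf, ← h, cellAt_of]⟩

theorem sub_toGrid_mem_range_centerOf {c : Fin n → Fin (2 * r + 1)} {y : Grid n} :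
    y - toGrid c ∈ Set.range (centerOf r) ↔ y ∈ centers r c := by
  rw [range_centerOf, centers, Set.mem_ofPred_eq, Set.mem_ofPred_eq, ← add_left_inj c,
    ← offsetOf_add_toGrid, sub_add_cancel]

theorem disjoint_centers {c c' : Fin n → Fin (2 * r + 1)} (h : c ≠ c') :
    Disjoint (centers r c) (centers r c') :=
  Set.disjoint_left.2 fun _ hy hy' => h (add_left_cancel (hy.symm.trans hy'))

end Centers

section Circuit

variable {n r : ℕ} {A : Type u} [Fintype A] [Zero A] [DecidableEq A] {G : Op n A}

namespace HasRadius

theorem onFirst_gateAt (hG : HasRadius r G) (c : Fin n → Fin (2 * r + 1))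
    (φ : StateSpace n (A × A)) :
    onFirst hG.unitary (gateAt c hG.gate φ) =
      relabel (exchange (centers r c)) (onFirst hG.unitary φ) := by
  have h : (onFirst hG.unitary).toContinuousLinearMap ∘L
        conjRelabel (group (2 * r + 1)).symm (hG.gate.tensor n) =
      (relabel (exchange (n := n) (A := A) (Set.range (centerOf r))) :
        StateSpace n (A × A) →L[ℂ] StateSpace n (A × A)) ∘L
          (onFirst hG.unitary).toContinuousLinearMap :=
    clm_ext_ket hG.onFirst_tensor_gate
  have hgate : translation (toGrid c) (gateAt c hG.gate φ) =
      conjRelabel (group (2 * r + 1)).symm (hG.gate.tensor n) (translation (toGrid c) φ) := by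
    rw [show gateAt c hG.gate φ = (translation (toGrid c)).symm (conjRelabel
      (group (2 * r + 1)).symm (hG.gate.tensor n) (translation (toGrid c) φ)) from rfl,
      LinearIsometryEquiv.apply_symm_apply]
  apply (translation (toGrid c)).injective
  rw [← onFirst_translation _ (hG.translation_comm _), hgate]
  refine (DFunLike.congr_fun h _).trans ?_
  change relabel _ (onFirst hG.unitary (translation (toGrid c) φ)) = _
  rw [onFirst_translation _ (hG.translation_comm _), relabel_exchange_translation]
  simp only [sub_toGrid_mem_range_centerOf, Set.ofPred_mem_eq]

theorem onFirst_circuit (hG : HasRadius r G) {N : ℕ} {c : ℕ → Fin n → Fin (2 * r + 1)}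
    {W : ℕ → LocalIsometry (Block n (2 * r + 1) (A × A)) (Block n (2 * r + 1) (A × A))}
    (hc : Set.InjOn (fun a => c (a + 1)) (Set.Iio N)) (hW : ∀ a < N, W a = hG.gate)
    (φ : StateSpace n (A × A)) {a : ℕ} (ha : a ≤ N) :
    onFirst hG.unitary (circuit c W a φ) =
      relabel (exchange (⋃ i < a, centers r (c (i + 1)))) (onFirst hG.unitary φ) := by
  induction a with
  | zero =>
    ext q
    simp only [not_lt_zero, Set.iUnion_of_empty, Set.iUnion_empty]
    exact congrArg _ (exchange_empty q).symm
  | succ a ih =>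
    have hdisj : Disjoint (centers r (c (a + 1))) (⋃ i < a, centers r (c (i + 1))) := by
      simp only [Set.disjoint_iUnion_right]
      intro i hi
      refine disjoint_centers fun h => ?_
      exact hi.ne' (hc (Set.mem_Iio.2 ha) (Set.mem_Iio.2 (hi.trans ha)) h)
    rw [Set.biUnion_lt_succ, Set.union_comm, ← relabel_exchange_exchange hdisj,
      ← ih (Nat.le_of_succ_le ha), ← hG.onFirst_gateAt, ← hW a ha]
    rfl

end HasRadius

/-- The gate that swaps the two layers of a supercell. -/
def swapGate (n L : ℕ) (A : Type u) [Fintype A] [Zero A] [DecidableEq A] :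
    LocalIsometry (Block n L (A × A)) (Block n L (A × A)) :=
  .ofInjective (fun w p => (w p).swap)
    (Function.LeftInverse.injective (g := fun w p => (w p).swap) fun _ => rfl) rfl

theorem gateAt_swapGate {L : ℕ} [NeZero L] (c : Fin n → Fin L) (φ : StateSpace n (A × A)) :
    gateAt c (swapGate n L A) φ = relabel (exchange Set.univ) φ := by
  have h : gateAt c (swapGate n L A) = (relabel (exchange (n := n) (A := A) Set.univ) :
      StateSpace n (A × A) →L[ℂ] StateSpace n (A × A)) := by
    refine clm_ext_ket fun q => ?_
    change _ = relabel (exchange Set.univ) (ket q)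
    rw [gateAt, conjRelabel_ket, swapGate, LocalIsometry.tensor_ofInjective_ket, relabel_ket,
      relabel_ket]
    congr 1
    rw [Equiv.symm_symm, Equiv.symm_apply_eq]
    ext1 x
    funext p
    exact (if_pos (Set.mem_univ _)).symm
  rw [h]
  rfl

theorem exists_enumeration (n L : ℕ) [NeZero L] : ∃ (N : ℕ) (c : ℕ → Fin n → Fin L),
    c 0 = 0 ∧ c (N + 1) = 0 ∧ Set.BijOn (fun a => c (a + 1)) (Set.Iio N) Set.univ := by
  obtain ⟨N, ⟨e⟩⟩ := Finite.exists_equiv_fin (Fin n → Fin L)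
  let c : ℕ → Fin n → Fin L
    | 0 => 0
    | a + 1 => if h : a < N then e.symm ⟨a, h⟩ else 0
  refine ⟨N, c, rfl, dif_neg (lt_irrefl N), fun _ _ => Set.mem_univ _, fun a ha b hb h => ?_,
    fun p _ => ⟨e p, (e p).2, ?_⟩⟩
  · have h' : e.symm ⟨a, ha⟩ = e.symm ⟨b, hb⟩ := by
      simpa only [c, dif_pos (Set.mem_Iio.1 ha), dif_pos (Set.mem_Iio.1 hb)] using h
    exact congrArg Fin.val (e.symm.injective h')
  · change c (e p + 1) = p
    simp only [c, dif_pos (e p).2, Fin.eta, Equiv.symm_apply_apply]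

theorem HasRadius.exists_circuit (hG : HasRadius r G) :
    ∃ (m : ℕ) (_ : NeZero m) (c : ℕ → Fin n → Fin (2 * r + 1))
      (W : ℕ → LocalIsometry (Block n (2 * r + 1) (A × A)) (Block n (2 * r + 1) (A × A))),
      c m = c 0 ∧
        circuit c W m ∘L embed (withSecond 0) = embed (withSecond 0) ∘L G := by
  obtain ⟨N, c, h0, hN, -, hinj, hsurj⟩ := exists_enumeration n (2 * r + 1)
  refine ⟨N + 1, inferInstance, c, fun a => if a < N then hG.gate else swapGate n _ A,
    hN.trans h0.symm, clm_ext_ket fun b => ?_⟩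
  set W : ℕ → LocalIsometry (Block n (2 * r + 1) (A × A)) (Block n (2 * r + 1) (A × A)) :=
    fun a => if a < N then hG.gate else swapGate n _ A
  have hcover : ⋃ i < N, centers r (c (i + 1)) = Set.univ := by
    refine Set.eq_univ_of_forall fun y => ?_
    obtain ⟨i, hi, h⟩ := hsurj (Set.mem_univ (offsetOf (2 * r + 1) y - center n r))
    refine Set.mem_iUnion₂.2 ⟨i, hi, ?_⟩
    exact sub_eq_iff_eq_add'.1 h.symm
  have hgates : circuit c W N (ket (layers b 0)) = embed (withFirst 0) (G (ket b)) := by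
    apply (onFirst hG.unitary).injective
    rw [hG.onFirst_circuit hinj (fun a ha => if_pos ha) _ le_rfl, hcover, onFirst_ket,
      relabel_exchange_univ_embed, onFirst_embed_withFirst _ hG.quiescent]
  change gateAt _ (W N) (circuit c W N (embed (withSecond 0) (ket b))) =
    embed (withSecond 0) (G (ket b))
  rw [embed_ket, withSecond_apply, hgates, ← relabel_exchange_univ_embed,
    show W N = swapGate n _ A from if_neg (lt_irrefl N), gateAt_swapGate,
    relabel_exchange_self]

end Circuit

/-! ### Simulation of a QCA -/

section Simulation

open LocalIsometry

variable {n : ℕ}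

theorem grouped_evolution_comp_tensor {L : ℕ} [NeZero L] {A : Type u} [Fintype A] [Zero A]
    [DecidableEq A] {B : Type v} [Fintype B] [Zero B] [DecidableEq B] {U : ScatteringUnitary n B}
    {k : ℕ} {E : LocalIsometry (Block n L A) (Block n 2 B)} {G : Op n A}
    (h : U.evolution k ∘L encode (group L) E 0 = encode (group L) E 0 ∘L G) :
    grouped 2 (U.evolution k) ∘L E.tensor n = E.tensor n ∘L grouped L G := by
  ext1 φ
  have h' := DFunLike.congr_fun h ((relabel (group L)).symm φ)
  change U.evolution k (relabel (hypercubes 0).symm (E.tensor n (relabel (group L) _))) =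
    relabel (hypercubes 0).symm (E.tensor n (relabel (group L) (G _))) at h'
  rw [LinearIsometryEquiv.apply_symm_apply, hypercubes_of_even Even.zero] at h'
  apply (relabel (group 2)).symm.injective
  refine Eq.trans ?_ h'
  exact (relabel (group 2)).symm_apply_apply _

variable {A : Type u} [Fintype A] [Zero A] [DecidableEq A]

/-- The encoding of a supercell as the first layer of a two-layered supercell. -/
def blockWithZero (n L : ℕ) (A : Type u) [Fintype A] [Zero A] [DecidableEq A] :
    LocalIsometry (Block n L A) (Block n L (A × A)) :=
  ofInjective (fun w p => (w p, 0))
    (Function.LeftInverse.injective (g := fun w p => (w p).1) fun _ => rfl) rfl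

theorem encode_comp_blockWithZero {L : ℕ} [NeZero L] {B : Type v} [Fintype B] [Zero B]
    [DecidableEq B] (I : LocalIsometry (Block n L (A × A)) (Block n 2 B)) (t : ℕ) :
    encode (group L) (I.comp (blockWithZero n L A)) t =
      encode (group L) I t ∘L embed (withSecond 0) := by
  refine clm_ext_ket fun b => ?_
  have h : (group L b).mapRange (fun (w : Block n L A) p => (w p, (0 : A))) rfl =
      group L (layers b 0) := by
    ext1 x
    rfl
  rw [ContinuousLinearMap.comp_apply, embed_ket, withSecond_apply, encode, encode, tensor_comp]
  change relabel _ (I.tensor n ((blockWithZero n L A).tensor n (relabel (group L) (ket b)))) =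
    relabel _ (I.tensor n (relabel (group L) (ket (layers b 0))))
  rw [relabel_ket, relabel_ket, blockWithZero, tensor_ofInjective_ket, h]

theorem HasRadius.exists_intrinsicallySimulates {r : ℕ} {G : Op n A} (hG : HasRadius r G) :
    ∃ (B : Type u) (_ : Fintype B) (_ : Zero B) (_ : DecidableEq B)
      (U : ScatteringUnitary n B), IntrinsicallySimulates U G := by
  obtain ⟨m, hm, c, W, hc, hW⟩ := hG.exists_circuit
  obtain ⟨U, hU⟩ := exists_evolution_comp_encode c W hc
  refine ⟨_, inferInstance, inferInstance, inferInstance, U, 2 * r + 1, 2, 2 * m, inferInstance,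
    inferInstance, even_two, even_two_mul m, Nat.pos_of_ne_zero (NeZero.ne _),
    ((track 0).comp (splitEven (c 0))).comp (blockWithZero n _ A), ?_⟩
  apply grouped_evolution_comp_tensor
  rw [encode_comp_blockWithZero, ← ContinuousLinearMap.comp_assoc, hU,
    ContinuousLinearMap.comp_assoc, hW, ContinuousLinearMap.comp_assoc]

end Simulation

/-! ### Normalization of the phase -/

section Phase

variable {n : ℕ} {A : Type u} [Zero A] {G : Op n A}

theorem translation_zero (ψ : StateSpace n A) : translation (0 : Grid n) ψ = ψ := by
  rw [translation, shift_zero]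
  rfl

theorem shift_add (v w : Grid n) (c : Config n A) : shift (v + w) c = shift v (shift w c) := by
  ext x
  rw [shift_apply, shift_apply, shift_apply, add_assoc]

theorem translation_add (v w : Grid n) (ψ : StateSpace n A) :
    translation (v + w) ψ = translation v (translation w ψ) := by
  have h : (translation (A := A) (v + w) : StateSpace n A →L[ℂ] StateSpace n A) =
      (translation (A := A) v : StateSpace n A →L[ℂ] StateSpace n A) ∘L
        (translation (A := A) w : StateSpace n A →L[ℂ] StateSpace n A) := by
    refine clm_ext_ket fun c => ?_
    change translation (v + w) (ket c) = translation v (translation w (ket c))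
    rw [translation_ket, translation_ket, translation_ket, shift_add]
  exact DFunLike.congr_fun h ψ

theorem TranslationInvariant.translation_comm (hG : TranslationInvariant G) (v : Grid n)
    (ψ : StateSpace n A) : G (translation v ψ) = translation v (G ψ) := by
  let H : AddSubgroup (Grid n) :=
    { carrier := {v | ∀ ψ, G (translation v ψ) = translation v (G ψ)}
      zero_mem' := fun ψ => by rw [translation_zero, translation_zero]
      add_mem' := fun {v w} hv hw ψ => by rw [translation_add, hv, hw, ← translation_add]
      neg_mem' := fun {v} hv ψ => by
        apply (translation v).injective
        rw [← hv, ← translation_add, ← translation_add, add_neg_cancel, translation_zero,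
          translation_zero] }
  have hv : v ∈ H := by
    have hsum : v = ∑ k, v k • (Pi.single k (1 : ℤ) : Grid n) := by
      ext i
      simp [Finset.sum_apply, Pi.single_apply]
    rw [hsum]
    exact sum_mem fun k _ => zsmul_mem (show Pi.single k (1 : ℤ) ∈ H from hG k) _
  exact hv ψ

theorem sum_support_shift (v : Grid n) (k : Fin n) (c : Config n A) :
    ∑ x ∈ (shift v c).support, x k = ∑ x ∈ c.support, x k - c.support.card * v k := by
  change ∑ x ∈ c.support.map (Equiv.subRight v).toEmbedding, x k = _
  simp [Finset.sum_map, Finset.sum_sub_distrib]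

theorem shift_injective {n : ℕ} [NeZero n] {c : Config n A} (hc : c ≠ 0) :
    Function.Injective fun j : ℕ => shift (fun _ => (j : ℤ)) c := by
  intro i j h
  have hsum := sum_support_shift (fun _ => (i : ℤ)) 0 c
  rw [show shift _ c = shift _ c from h, sum_support_shift, sub_right_inj] at hsum
  have hcard : (c.support.card : ℤ) ≠ 0 := by
    exact_mod_cast (Finset.card_pos.2 (Finsupp.support_nonempty_iff.2 hc)).ne'
  exact_mod_cast (mul_left_cancel₀ hcard hsum).symm

theorem apply_shift_of_translation_eq {χ : StateSpace n A} (h : ∀ v, translation v χ = χ)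
    (v : Grid n) (c : Config n A) : χ (shift v c) = χ c := by
  calc χ (shift v c) = inner ℂ (translation v (ket c)) (translation v χ) := by
        rw [h, translation_ket, inner_ket_left]
    _ = χ c := by rw [LinearIsometryEquiv.inner_map_map, inner_ket_left]

theorem eq_smul_ket_zero_of_translation_eq {n : ℕ} [NeZero n] {χ : StateSpace n A}
    (h : ∀ v, translation v χ = χ) : χ = χ 0 • ket 0 := by
  classical
  ext c
  rw [lp.coeFn_smul, Pi.smul_apply, ket_apply, smul_eq_mul]
  split_ifs with hc
  · rw [hc, mul_one]
  · have hsum : Summable fun d => ‖χ d‖ ^ (2 : ENNReal).toReal :=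
      (memℓp_gen_iff (by norm_num)).1 (lp.memℓp χ)
    have hconst := hsum.comp_injective (shift_injective hc)
    simp only [Function.comp_def, apply_shift_of_translation_eq h, summable_const_iff] at hconst
    simpa using hconst

theorem IsQCA.exists_phase (hn : 1 ≤ n) (hG : IsQCA G) :
    ∃ z : ℂ, ‖z‖ = 1 ∧ (z • G) (ket 0) = ket 0 := by
  have : NeZero n := ⟨by omega⟩
  obtain ⟨a, ha⟩ : ∃ a : ℂ, G (ket 0) = a • ket 0 :=
    ⟨_, eq_smul_ket_zero_of_translation_eq fun v => by
      rw [← hG.translationInvariant.translation_comm, translation_ket, shift_zero_config]⟩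
  have hnorm : ‖a‖ = 1 := by
    have h := ContinuousLinearMap.norm_map_of_mem_unitary hG.unitary (ket 0)
    rwa [ha, norm_smul, norm_ket, mul_one] at h
  have hne : a ≠ 0 := norm_ne_zero_iff.1 (by rw [hnorm]; exact one_ne_zero)
  refine ⟨a⁻¹, by rw [norm_inv, hnorm, inv_one], ?_⟩
  rw [smul_apply, ha, smul_smul, inv_mul_cancel₀ hne, one_smul]

theorem exists_radius (N : Finset (Grid n)) : ∃ r : ℕ, ∀ y ∈ N, ∀ i, |y i| ≤ r := by
  refine ⟨N.sup fun y => Finset.univ.sup fun i => (y i).natAbs, fun y hy i => ?_⟩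
  rw [Int.abs_eq_natAbs, Int.ofNat_le]
  exact (Finset.le_sup (f := fun i => (y i).natAbs) (Finset.mem_univ i)).trans
    (Finset.le_sup (f := fun y : Grid n => Finset.univ.sup fun i => (y i).natAbs) hy)

theorem IsQCA.exists_hasRadius (hG : IsQCA G) {z : ℂ} (hz : ‖z‖ = 1)
    (h0 : (z • G) (ket 0) = ket 0) : ∃ r, HasRadius r (z • G) := by
  obtain ⟨N, hN⟩ := hG.causal
  obtain ⟨r, hr⟩ := exists_radius N
  have hz' : z ∈ _root_.unitary ℂ := Unitary.mem_iff_star_mul_self.2 (by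
    rw [Complex.star_def, ← Complex.normSq_eq_conj_mul_self, Complex.normSq_eq_norm_sq, hz,
      one_pow, Complex.ofReal_one])
  refine ⟨r, Unitary.smul_mem_of_mem hz' hG.unitary, fun v ψ => ?_, h0, fun x u v => ?_⟩
  · rw [smul_apply, smul_apply, hG.translationInvariant.translation_comm, map_smul]
  · rw [heisenberg_smul hz]
    refine (hN.isLocalOn x u v).mono fun y hy i => ?_
    obtain ⟨w, hw, rfl⟩ := Finset.mem_map.1 (Finset.mem_coe.1 hy)
    simpa using hr w hw i

end Phase

end QCA

end

theorem theorem2 (n : ℕ) (hn : 1 ≤ n) (A : Type u) [Fintype A] [Zero A] [DecidableEq A]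
    (G : QCA.Op n A) (hG : QCA.IsQCA G) :
    ∃ z : ℂ, ‖z‖ = 1 ∧ (z • G) (QCA.ket 0) = QCA.ket 0 ∧
      ∃ (B : Type u) (_ : Fintype B) (_ : Zero B) (_ : DecidableEq B)
        (U : QCA.ScatteringUnitary n B), QCA.IntrinsicallySimulates U (z • G) := by
  obtain ⟨z, hz, h0⟩ := hG.exists_phase hn
  obtain ⟨r, hr⟩ := hG.exists_hasRadius hz h0
  exact ⟨z, hz, h0, hr.exists_intrinsicallySimulates⟩
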